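/- Let $n\ge 2$, let $\alpha=(\alpha_1,\dots,\alpha_n)$ with $\alpha_k\in(-\pi,\pi)\setminus\{0\}$ for all $k$, and put $K_\alpha(\mathbf x,\boldsymbol\xi)=\prod_{k=1}^n K_{\alpha_k}(x_k,\xi_k)$ with $$K_{\alpha_k}(x_k,\xi_k)=\sqrt{\tfrac{1-i\cot\alpha_k}{2\pi}}\;e^{i\left(\frac{x_k^2+\xi_k^2}{2}\cot\alpha_k-x_k\xi_k\csc\alpha_k\right)}$$ (principal square root). Let $\mathbb Y^{2n}=\mathbb S^{n-1}\times\mathbb R\times\mathbb R^n$, with normalized surface measure on $\mathbb S^{n-1}$, and let $\mathcal S(\mathbb Y^{2n})$ be the space of all $\Phi\in C^\infty(\mathbb Y^{2n})$ such that $$\rho_{s,r}^{l,m,k}(\Phi)=\sup_{(\mathbf u,b,\mathbf a)\in\mathbb Y^{2n}}(1+|b|^2)^{r/2}(1+|\mathbf a|^2)^{s/2}\,|\partial_{\mathbf a}^l\partial_b^m\Delta_{\mathbf u}^k\Phi(\mathbf u,b,\mathbf a)|<\infty$$ for all $s,r,m,k\in\mathbb N_0$, $l\in\mathbb N_0^n$,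 where $\Delta_{\mathbf u}$ is the Laplace–Beltrami operator on $\mathbb S^{n-1}$; it is topologized by these seminorms, and $\mathcal S'(\mathbb Y^{2n})$ is its dual. For $\psi\in\mathcal S(\mathbb R)$, $\varphi\in\mathcal S(\mathbb R^n)$ and $\Phi\in\mathcal S(\mathbb Y^{2n})$ put $$DS_\psi^\alpha\varphi(\mathbf u,b,\mathbf a)=\int_{\mathbb R^n}\varphi(\mathbf x)\,\overline{\psi(\mathbf u\cdot\mathbf x-b)}\,K_\alpha(\mathbf x,\mathbf a)\,d\mathbf x,$$ $$(DS_\psi^\alpha)^*\Phi(\mathbf x)=\int_{\mathbb S^{n-1}}\int_{\mathbb R^n}\int_{\mathbb R}\Phi(\mathbf u,b,\mathbf a)\,\psi(\mathbf x\cdot\mathbf u-b)\,K_{-\alpha}(\mathbf x,\mathbf a)\,db\,d\mathbf a\,d\mathbf u .$$ Let $\psi,\eta\in\mathcal S(\mathbb R)$ be such that $\eta$ is a synthesis window for $\psi$, that is, $(\eta,\psi)=\int_{\mathbb R}\eta\,\overline\psi\neq0$. Then the duality formulas $$\langle DS_\psi^\alpha f,\Phi\rangle=\big\langle f,\overline{(DS_\psi^\alpha)^*(\overline\Phi)}\big\rangle,\qquad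 f\in\mathcal S'(\mathbb R^n),\ \Phi\in\mathcal S(\mathbb Y^{2n}),$$ $$\langle (DS_\eta^\alpha)^*F,\varphi\rangle=\big\langle F,\overline{DS_\eta^\alpha(\overline\varphi)}\big\rangle,\qquad F\in\mathcal S'(\mathbb Y^{2n}),\ \varphi\in\mathcal S(\mathbb R^n),$$ define (uniquely) linear operators $DS_\psi^\alpha:\mathcal S'(\mathbb R^n)\to\mathcal S'(\mathbb Y^{2n})$ and $(DS_\eta^\alpha)^*:\mathcal S'(\mathbb Y^{2n})\to\mathcal S'(\mathbb R^n)$; in particular $\overline{(DS_\psi^\alpha)^*(\overline\Phi)}\in\mathcal S(\mathbb R^n)$ and $\overline{DS_\eta^\alpha(\overline\varphi)}\in\mathcal S(\mathbb Y^{2n})$ for all such $\Phi,\varphi$. These operators satisfy $$\frac1{(\eta,\psi)}\,(DS_\eta^\alpha)^*\circ DS_\psi^\alpha=\mathrm{Id}_{\mathcal S'(\mathbb R^n)} .$$ -/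

import Mathlib

open MeasureTheory
open scoped SchwartzMap Manifold ContDiff ComplexConjugate InnerProductSpace Laplacian

noncomputable section

namespace DSTFRFT

/-! Throughout, the dimension is `n = d + 1`. -/

/-- The Euclidean space `ℝⁿ`, `n = d + 1`. -/
abbrev E (d : ℕ) : Type := EuclideanSpace ℝ (Fin (d + 1))

/-- The unit sphere of `ℝⁿ`. -/
abbrev Sph (d : ℕ) : Type := Metric.sphere (0 : E d) 1

/-- The space `𝕐²ⁿ = 𝕊ⁿ⁻¹ × ℝ × ℝⁿ` of triples `(u, b, a)`. -/
abbrev Y (d : ℕ) : Type := Sph d × ℝ × E d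

/-- The rotation invariant (surface) measure on the sphere, normalized to total mass one. -/
def sphereMeasure (d : ℕ) : Measure (Sph d) :=
  ((volume : Measure (E d)).toSphere Set.univ)⁻¹ • (volume : Measure (E d)).toSphere

/-! ### Differential operators on `𝕐²ⁿ` -/

/-- Smooth complex valued functions on the manifold `𝕐²ⁿ`. -/
def IsSmoothY {d : ℕ} (Φ : Y d → ℂ) : Prop :=
  ContMDiff ((𝓡 d).prod 𝓘(ℝ, ℝ × E d)) 𝓘(ℝ, ℂ) ∞ Φ

/-- The radial projection `x ↦ x / |x|` onto the sphere (the value at the origin is irrelevant). -/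
def radialProj {d : ℕ} (x : E d) : Sph d :=
  if hx : x = 0 then ⟨EuclideanSpace.single 0 1, by simp⟩
  else ⟨‖x‖⁻¹ • x, by simp [norm_smul, hx]⟩

/-- The Laplace-Beltrami operator of the sphere: the Euclidean Laplacian of the extension
`x ↦ g (x / |x|)`, restricted to the sphere. -/
def sphereLaplacian {d : ℕ} (g : Sph d → ℂ) (u : Sph d) : ℂ :=
  (Δ (fun x : E d => g (radialProj x))) (u : E d)

/-- The Laplace-Beltrami operator `Δ_u` in the spherical variable. -/
def laplaceU {d : ℕ} (Φ : Y d → ℂ) : Y d → ℂ :=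
  fun y => sphereLaplacian (fun u => Φ (u, y.2)) y.1

/-- The partial derivative `∂_b`. -/
def partialB {d : ℕ} (Φ : Y d → ℂ) : Y d → ℂ :=
  fun y => deriv (fun b : ℝ => Φ (y.1, b, y.2.2)) y.2.1

/-- The partial derivative in the coordinate `a_k`. -/
def partialA {d : ℕ} (k : Fin (d + 1)) (Φ : Y d → ℂ) : Y d → ℂ :=
  fun y => lineDeriv ℝ (fun a : E d => Φ (y.1, y.2.1, a)) y.2.2 (EuclideanSpace.single k 1)

/-- The partial derivative `∂_a^l` for a multi-index `l`. -/
def multiPartialA {d : ℕ} (l : Fin (d + 1) → ℕ) (Φ : Y d → ℂ) : Y d → ℂ :=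
  (List.finRange (d + 1)).foldr (fun k Ψ => (partialA k)^[l k] Ψ) Φ

/-- The derivative `∂_a^l ∂_b^m Δ_u^k`. -/
def derivY {d : ℕ} (l : Fin (d + 1) → ℕ) (m k : ℕ) (Φ : Y d → ℂ) : Y d → ℂ :=
  multiPartialA l (partialB^[m] (laplaceU^[k] Φ))

/-! The operators above act linearly on smooth functions. -/

lemma factFinrankE (d : ℕ) : Fact (Module.finrank ℝ (E d) = d + 1) := ⟨by simp⟩

lemma contMDiffAt_radialProj {d : ℕ} {x : E d} (hx : x ≠ 0) :
    ContMDiffAt 𝓘(ℝ, E d) (𝓡 d) ∞ (radialProj (d := d)) x := by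
  have := factFinrankE d
  let U : TopologicalSpace.Opens (E d) := ⟨{0}ᶜ, isOpen_compl_singleton⟩
  let x' : U := ⟨x, hx⟩
  have key : ContMDiff 𝓘(ℝ, E d) (𝓡 d) ∞ (fun z : U => radialProj (z : E d)) := by
    have h1 : ContMDiff 𝓘(ℝ, E d) 𝓘(ℝ, E d) ∞ (fun z : U => ‖(z : E d)‖⁻¹ • (z : E d)) := by
      intro z
      have hz : (z : E d) ≠ 0 := z.2
      have : ContMDiffAt 𝓘(ℝ, E d) 𝓘(ℝ, E d) ∞ (fun w : E d => ‖w‖⁻¹ • w) (z : E d) := by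
        rw [contMDiffAt_iff_contDiffAt]
        exact ((contDiffAt_norm ℝ hz).inv (norm_ne_zero_iff.2 hz)).smul contDiffAt_id
      exact (contMDiffAt_subtype_iff (f := fun w : E d => ‖w‖⁻¹ • w)).2 this
    have h2 : ∀ z : U, ‖(z : E d)‖⁻¹ • (z : E d) ∈ Metric.sphere (0 : E d) 1 := by
      intro z
      have hz : (z : E d) ≠ 0 := z.2
      simp [norm_smul, hz]
    have h3 := h1.codRestrict_sphere (n := d) h2
    have h4 : (fun z : U => radialProj (z : E d)) = Set.codRestrict _ _ h2 := by
      funext z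
      have hz : (z : E d) ≠ 0 := z.2
      ext1
      simp [radialProj, hz]
    rw [h4]
    exact h3
  exact (contMDiffAt_subtype_iff (x := x') (f := radialProj (d := d))).1 (key x')

/-- The extension of a function on `𝕐²ⁿ` that is constant along rays in the first variable. -/
def extY {d : ℕ} (Φ : Y d → ℂ) (q : E d × ℝ × E d) : ℂ := Φ (radialProj q.1, q.2)

lemma radialProj_coe {d : ℕ} (u : Sph d) : radialProj (u : E d) = u := by
  have h : ‖(u : E d)‖ = 1 := by simp
  have h0 : (u : E d) ≠ 0 := by intro h'; simp [h'] at h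
  ext1
  simp [radialProj, h0]

lemma coe_ne_zero {d : ℕ} (u : Sph d) : (u : E d) ≠ 0 := by
  have h : ‖(u : E d)‖ = 1 := by simp
  intro h'; simp [h'] at h

lemma IsSmoothY.contDiffAt_extY {d : ℕ} {Φ : Y d → ℂ} (h : IsSmoothY Φ)
    {q : E d × ℝ × E d} (hq : q.1 ≠ 0) : ContDiffAt ℝ ∞ (extY Φ) q := by
  rw [← contMDiffAt_iff_contDiffAt]
  have h1 : ContMDiffAt 𝓘(ℝ, E d × ℝ × E d) ((𝓡 d).prod 𝓘(ℝ, ℝ × E d)) ∞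
      (fun q : E d × ℝ × E d => ((radialProj q.1, q.2) : Y d)) q := by
    refine ContMDiffAt.prodMk ?_ ?_
    · exact ContMDiffAt.comp q (contMDiffAt_radialProj hq)
        (contMDiffAt_iff_contDiffAt.2 contDiffAt_fst)
    · exact contMDiffAt_iff_contDiffAt.2 contDiffAt_snd
  exact ContMDiffAt.comp q (h _) h1

lemma isSmoothY_of_contDiffAt {d : ℕ} {Φ : Y d → ℂ} {G : E d × ℝ × E d → ℂ}
    (hG : ∀ q : E d × ℝ × E d, q.1 ≠ 0 → ContDiffAt ℝ ∞ G q)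
    (hΦ : ∀ y : Y d, Φ y = G ((y.1 : E d), y.2)) : IsSmoothY Φ := by
  have := factFinrankE d
  intro y
  have h1 : ContMDiffAt ((𝓡 d).prod 𝓘(ℝ, ℝ × E d)) 𝓘(ℝ, E d × ℝ × E d) ∞
      (fun y : Y d => (((y.1 : E d), y.2) : E d × ℝ × E d)) y := by
    refine ContMDiffAt.prodMk_space ?_ ?_
    · exact ContMDiffAt.comp y (contMDiff_coe_sphere (E := E d) (n := d) y.1) contMDiffAt_fst
    · exact contMDiffAt_snd
  have h2 := ContMDiffAt.comp y
    (contMDiffAt_iff_contDiffAt.2 (hG ((y.1 : E d), y.2) (coe_ne_zero y.1))) h1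
  have : Φ = G ∘ (fun y : Y d => (((y.1 : E d), y.2) : E d × ℝ × E d)) := funext hΦ
  rw [this]
  exact h2

/-- An operator on functions on `𝕐²ⁿ` that preserves smoothness and is linear on smooth
functions. -/
structure IsSmoothOp {d : ℕ} (D : (Y d → ℂ) → (Y d → ℂ)) : Prop where
  smooth : ∀ Φ, IsSmoothY Φ → IsSmoothY (D Φ)
  add : ∀ Φ Ψ, IsSmoothY Φ → IsSmoothY Ψ → D (Φ + Ψ) = D Φ + D Ψ
  smul : ∀ (c : ℂ) Φ, IsSmoothY Φ → D (c • Φ) = c • D Φ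

lemma IsSmoothOp.comp {d : ℕ} {D₁ D₂ : (Y d → ℂ) → (Y d → ℂ)} (h₁ : IsSmoothOp D₁)
    (h₂ : IsSmoothOp D₂) : IsSmoothOp (fun Φ => D₁ (D₂ Φ)) where
  smooth Φ h := h₁.smooth _ (h₂.smooth _ h)
  add Φ Ψ h h' := by rw [h₂.add _ _ h h', h₁.add _ _ (h₂.smooth _ h) (h₂.smooth _ h')]
  smul c Φ h := by rw [h₂.smul _ _ h, h₁.smul _ _ (h₂.smooth _ h)]

lemma IsSmoothOp.id {d : ℕ} : IsSmoothOp (fun Φ : Y d → ℂ => Φ) where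
  smooth _ h := h
  add _ _ _ _ := rfl
  smul _ _ _ := rfl

lemma IsSmoothOp.iterate {d : ℕ} {D : (Y d → ℂ) → (Y d → ℂ)} (h : IsSmoothOp D) (k : ℕ) :
    IsSmoothOp D^[k] := by
  induction k with
  | zero => exact IsSmoothOp.id
  | succ k ih => rw [Function.iterate_succ']; exact h.comp ih

lemma IsSmoothY.add {d : ℕ} {Φ Ψ : Y d → ℂ} (h : IsSmoothY Φ) (h' : IsSmoothY Ψ) :
    IsSmoothY (Φ + Ψ) := ContMDiff.add h h'

lemma IsSmoothY.smul {d : ℕ} {Φ : Y d → ℂ} (c : ℂ) (h : IsSmoothY Φ) :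
    IsSmoothY (c • Φ) :=
  isSmoothY_of_contDiffAt (G := c • extY Φ) (fun _ hq => (h.contDiffAt_extY hq).const_smul c)
    (fun y => by simp [extY, radialProj_coe])

/-- Directional derivatives of the extension in the variables `(b, a)`. -/
lemma isSmoothOp_of_dir {d : ℕ} {D : (Y d → ℂ) → (Y d → ℂ)} (v : ℝ × E d)
    (hD : ∀ Φ, IsSmoothY Φ → ∀ y : Y d,
      D Φ y = fderiv ℝ (extY Φ) ((y.1 : E d), y.2) (0, v)) : IsSmoothOp D where
  smooth Φ h := by
    refine isSmoothY_of_contDiffAt (G := fun q => fderiv ℝ (extY Φ) q (0, v)) ?_ (hD Φ h)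
    intro q hq
    exact ((h.contDiffAt_extY hq).fderiv_right (m := ∞) (by simp)).clm_apply contDiffAt_const
  add Φ Ψ h h' := by
    funext y
    have e : extY (Φ + Ψ) = extY Φ + extY Ψ := rfl
    rw [Pi.add_apply, hD _ (h.add h'), hD _ h, hD _ h', e, fderiv_add, add_apply]
    · exact (h.contDiffAt_extY (coe_ne_zero y.1)).differentiableAt (by simp)
    · exact (h'.contDiffAt_extY (coe_ne_zero y.1)).differentiableAt (by simp)
  smul c Φ h := by
    funext y
    have e : extY (c • Φ) = c • extY Φ := rfl
    rw [Pi.smul_apply, hD _ (h.smul c), hD _ h, e, fderiv_const_smul,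
      smul_apply]
    exact (h.contDiffAt_extY (coe_ne_zero y.1)).differentiableAt (by simp)

lemma isSmoothOp_partialB {d : ℕ} : IsSmoothOp (partialB (d := d)) := by
  refine isSmoothOp_of_dir (1, 0) fun Φ h y => ?_
  have h1 := ((h.contDiffAt_extY (q := ((y.1 : E d), y.2)) (coe_ne_zero y.1)).differentiableAt
    (by simp)).hasFDerivAt
  have h2 : HasDerivAt (fun b : ℝ => (((y.1 : E d), b, y.2.2) : E d × ℝ × E d)) (0, 1, 0) y.2.1 :=
    (hasDerivAt_const _ _).prodMk ((hasDerivAt_id _).prodMk (hasDerivAt_const _ _))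
  have h3 := HasFDerivAt.comp_hasDerivAt (f := fun b : ℝ =>
    (((y.1 : E d), b, y.2.2) : E d × ℝ × E d)) y.2.1 h1 h2
  have h4 : (extY Φ ∘ fun b : ℝ => (((y.1 : E d), b, y.2.2) : E d × ℝ × E d)) =
      fun b : ℝ => Φ (y.1, b, y.2.2) := by
    funext b; simp [extY, radialProj_coe]
  rw [h4] at h3
  exact h3.deriv

lemma isSmoothOp_partialA {d : ℕ} (k : Fin (d + 1)) : IsSmoothOp (partialA (d := d) k) := by
  refine isSmoothOp_of_dir (0, EuclideanSpace.single k 1) fun Φ h y => ?_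
  have h1 := ((h.contDiffAt_extY (q := ((y.1 : E d), y.2)) (coe_ne_zero y.1)).differentiableAt
    (by simp)).hasFDerivAt
  have h2 : HasFDerivAt (fun a : E d => (((y.1 : E d), y.2.1, a) : E d × ℝ × E d))
      ((0 : E d →L[ℝ] E d).prod ((0 : E d →L[ℝ] ℝ).prod (ContinuousLinearMap.id ℝ (E d)))) y.2.2 :=
    (hasFDerivAt_const _ _).prodMk ((hasFDerivAt_const _ _).prodMk (hasFDerivAt_id _))
  have h3 := HasFDerivAt.comp (f := fun a : E d =>
    (((y.1 : E d), y.2.1, a) : E d × ℝ × E d)) y.2.2 h1 h2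
  have h4 : (extY Φ ∘ fun a : E d => (((y.1 : E d), y.2.1, a) : E d × ℝ × E d)) =
      fun a : E d => Φ (y.1, y.2.1, a) := by
    funext b; simp [extY, radialProj_coe]
  rw [h4] at h3
  have h5 := (h3.hasLineDerivAt (EuclideanSpace.single k 1)).lineDeriv
  simpa [partialA] using h5

lemma contDiffAt_extY_slice {d : ℕ} {Φ : Y d → ℂ} (h : IsSmoothY Φ) (p : ℝ × E d) {x : E d}
    (hx : x ≠ 0) : ContDiffAt ℝ ∞ (fun x : E d => Φ (radialProj x, p)) x :=
  ContDiffAt.comp (f := fun x : E d => ((x, p) : E d × ℝ × E d)) (g := extY Φ) x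
    (h.contDiffAt_extY (q := (x, p)) hx) (contDiffAt_id.prodMk contDiffAt_const)

lemma laplacian_slice {d : ℕ} {Φ : Y d → ℂ} (h : IsSmoothY Φ) (p : ℝ × E d) {x : E d}
    (hx : x ≠ 0) : (Δ (fun x : E d => Φ (radialProj x, p))) x =
      ∑ i, fderiv ℝ (fun q => fderiv ℝ (extY Φ) q (EuclideanSpace.single i 1, 0)) (x, p)
        (EuclideanSpace.single i 1, 0) := by
  rw [InnerProductSpace.laplacian_eq_iteratedFDeriv_orthonormalBasis _
    (EuclideanSpace.basisFun (Fin (d + 1)) ℝ)]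
  refine Finset.sum_congr rfl fun i _ => ?_
  rw [iteratedFDeriv_two_apply]
  simp only [EuclideanSpace.basisFun_apply, Matrix.cons_val_zero, Matrix.cons_val_one]
  have hin : ∀ z : E d, HasFDerivAt (fun x : E d => ((x, p) : E d × ℝ × E d))
      ((ContinuousLinearMap.id ℝ (E d)).prod (0 : E d →L[ℝ] ℝ × E d)) z := fun z =>
    (hasFDerivAt_id _).prodMk (hasFDerivAt_const _ _)
  have step : (fun z => fderiv ℝ (fun x : E d => Φ (radialProj x, p)) z
      (EuclideanSpace.single i 1)) =ᶠ[nhds x]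
      fun z => fderiv ℝ (extY Φ) (z, p) (EuclideanSpace.single i 1, 0) := by
    filter_upwards [isOpen_ne.mem_nhds hx] with z hz
    have h1 := ((h.contDiffAt_extY (q := (z, p)) hz).differentiableAt (by simp)).hasFDerivAt
    have h3 := HasFDerivAt.comp (f := fun x : E d => ((x, p) : E d × ℝ × E d)) z h1 (hin z)
    have h4 : (extY Φ ∘ fun x : E d => ((x, p) : E d × ℝ × E d)) =
      fun x : E d => Φ (radialProj x, p) := rfl
    rw [h4] at h3
    rw [h3.fderiv]
    simp
  have hd : DifferentiableAt ℝ (fderiv ℝ (fun x : E d => Φ (radialProj x, p))) x :=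
    ((contDiffAt_extY_slice h p hx).fderiv_right (m := ∞) (by simp)).differentiableAt (by simp)
  have e1 : fderiv ℝ (fderiv ℝ (fun x : E d => Φ (radialProj x, p))) x
      (EuclideanSpace.single i 1) (EuclideanSpace.single i 1) =
      fderiv ℝ (fun z => fderiv ℝ (fun x : E d => Φ (radialProj x, p)) z
        (EuclideanSpace.single i 1)) x (EuclideanSpace.single i 1) := by
    rw [(hd.hasFDerivAt.clm_apply (hasFDerivAt_const (EuclideanSpace.single i 1) x)).fderiv]
    simp
  rw [e1, step.fderiv_eq]
  have hd2 : DifferentiableAt ℝ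
      (fun q => fderiv ℝ (extY Φ) q (EuclideanSpace.single i 1, 0)) (x, p) :=
    (((h.contDiffAt_extY (q := (x, p)) hx).fderiv_right (m := ∞) (by simp)).clm_apply
      contDiffAt_const).differentiableAt (by simp)
  have h3 := HasFDerivAt.comp (f := fun x : E d => ((x, p) : E d × ℝ × E d)) x
    hd2.hasFDerivAt (hin x)
  have h4 : ((fun q => fderiv ℝ (extY Φ) q (EuclideanSpace.single i 1, 0)) ∘
      fun x : E d => ((x, p) : E d × ℝ × E d)) =
      fun z => fderiv ℝ (extY Φ) (z, p) (EuclideanSpace.single i 1, 0) := rfl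
  rw [h4] at h3
  rw [h3.fderiv]
  simp

lemma isSmoothOp_laplaceU {d : ℕ} : IsSmoothOp (laplaceU (d := d)) where
  smooth Φ h := by
    refine isSmoothY_of_contDiffAt (G := fun q => ∑ i, fderiv ℝ (fun q => fderiv ℝ (extY Φ) q
      (EuclideanSpace.single i 1, 0)) q (EuclideanSpace.single i 1, 0)) ?_ ?_
    · intro q hq
      refine ContDiffAt.sum fun i _ => ?_
      exact ((((h.contDiffAt_extY hq).fderiv_right (m := ∞) (by simp)).clm_apply
        contDiffAt_const).fderiv_right (m := ∞) (by simp)).clm_apply contDiffAt_const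
    · intro y
      exact laplacian_slice h y.2 (coe_ne_zero y.1)
  add Φ Ψ h h' := by
    funext y
    exact ((contDiffAt_extY_slice h y.2 (coe_ne_zero y.1)).of_le
      (WithTop.coe_le_coe.2 le_top)).laplacian_add
      ((contDiffAt_extY_slice h' y.2 (coe_ne_zero y.1)).of_le (WithTop.coe_le_coe.2 le_top))
  smul c Φ h := by
    funext y
    exact InnerProductSpace.laplacian_smul c
      ((contDiffAt_extY_slice h y.2 (coe_ne_zero y.1)).of_le (WithTop.coe_le_coe.2 le_top))

lemma isSmoothOp_derivY {d : ℕ} (l : Fin (d + 1) → ℕ) (m k : ℕ) :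
    IsSmoothOp (derivY (d := d) l m k) := by
  have hA : IsSmoothOp (multiPartialA (d := d) l) := by
    unfold multiPartialA
    induction List.finRange (d + 1) with
    | nil => exact IsSmoothOp.id
    | cons j L ih => exact ((isSmoothOp_partialA j).iterate (l j)).comp ih
  exact hA.comp ((isSmoothOp_partialB.iterate m).comp (isSmoothOp_laplaceU.iterate k))

/-! ### The test function space `𝒮(𝕐²ⁿ)` and its dual -/

/-- The quantity `(1+|b|²)^{r/2} (1+|a|²)^{s/2} |∂_a^l ∂_b^m Δ_u^k Φ(u,b,a)|`. -/
def weightedY {d : ℕ} (s r : ℕ) (l : Fin (d + 1) → ℕ) (m k : ℕ) (Φ : Y d → ℂ) (y : Y d) : ℝ :=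
  (1 + |y.2.1| ^ 2) ^ ((r : ℝ) / 2) * (1 + ‖y.2.2‖ ^ 2) ^ ((s : ℝ) / 2) *
    ‖derivY l m k Φ y‖

lemma weightedY_nonneg {d : ℕ} (s r : ℕ) (l : Fin (d + 1) → ℕ) (m k : ℕ) (Φ : Y d → ℂ)
    (y : Y d) : 0 ≤ weightedY s r l m k Φ y := by
  unfold weightedY; positivity

lemma weightedY_add_le {d : ℕ} (s r : ℕ) (l : Fin (d + 1) → ℕ) (m k : ℕ) {Φ Ψ : Y d → ℂ}
    (h : IsSmoothY Φ) (h' : IsSmoothY Ψ) (y : Y d) :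
    weightedY s r l m k (Φ + Ψ) y ≤ weightedY s r l m k Φ y + weightedY s r l m k Ψ y := by
  unfold weightedY
  rw [(isSmoothOp_derivY l m k).add _ _ h h', ← mul_add]
  exact mul_le_mul_of_nonneg_left (norm_add_le _ _) (by positivity)

lemma weightedY_smul {d : ℕ} (s r : ℕ) (l : Fin (d + 1) → ℕ) (m k : ℕ) (c : ℂ) {Φ : Y d → ℂ}
    (h : IsSmoothY Φ) (y : Y d) :
    weightedY s r l m k (c • Φ) y = ‖c‖ * weightedY s r l m k Φ y := by
  unfold weightedY
  rw [(isSmoothOp_derivY l m k).smul _ _ h, Pi.smul_apply, norm_smul]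
  ring

/-- The subspace of the smooth functions on `𝕐²ⁿ` for which all the seminorms are finite. -/
def schwartzYSubmodule (d : ℕ) : Submodule ℂ (Y d → ℂ) where
  carrier := {Φ | IsSmoothY Φ ∧ ∀ (s r : ℕ) (l : Fin (d + 1) → ℕ) (m k : ℕ),
    BddAbove (Set.range (weightedY s r l m k Φ))}
  zero_mem' := by
    have h0 : IsSmoothY (0 : Y d → ℂ) := contMDiff_const
    refine ⟨h0, fun s r l m k => ⟨0, ?_⟩⟩
    rintro _ ⟨y, rfl⟩
    have := weightedY_smul s r l m k 0 h0 y
    simp only [zero_smul, norm_zero, zero_mul] at this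
    exact this.le
  add_mem' := by
    rintro Φ Ψ ⟨h, hb⟩ ⟨h', hb'⟩
    refine ⟨h.add h', fun s r l m k => ?_⟩
    obtain ⟨C, hC⟩ := hb s r l m k
    obtain ⟨C', hC'⟩ := hb' s r l m k
    refine ⟨C + C', ?_⟩
    rintro _ ⟨y, rfl⟩
    exact (weightedY_add_le s r l m k h h' y).trans
      (add_le_add (hC ⟨y, rfl⟩) (hC' ⟨y, rfl⟩))
  smul_mem' := by
    rintro c Φ ⟨h, hb⟩
    refine ⟨h.smul c, fun s r l m k => ?_⟩
    obtain ⟨C, hC⟩ := hb s r l m k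
    refine ⟨‖c‖ * C, ?_⟩
    rintro _ ⟨y, rfl⟩
    rw [weightedY_smul s r l m k c h y]
    exact mul_le_mul_of_nonneg_left (hC ⟨y, rfl⟩) (norm_nonneg c)

/-- The space `𝒮(𝕐²ⁿ)`. It is kept apart from the submodule above, so that it does not inherit
the topology of pointwise convergence. -/
def SchwartzY (d : ℕ) : Type := ↥(schwartzYSubmodule d)

instance (d : ℕ) : AddCommGroup (SchwartzY d) :=
  inferInstanceAs (AddCommGroup ↥(schwartzYSubmodule d))

instance (d : ℕ) : Module ℂ (SchwartzY d) :=
  inferInstanceAs (Module ℂ ↥(schwartzYSubmodule d))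

instance (d : ℕ) : CoeFun (SchwartzY d) (fun _ => Y d → ℂ) where
  coe Φ := Φ.1

/-- The seminorm `ρ_{s,r}^{l,m,k}` on `𝒮(𝕐²ⁿ)`. -/
def seminormY {d : ℕ} (s r : ℕ) (l : Fin (d + 1) → ℕ) (m k : ℕ) :
    Seminorm ℂ (SchwartzY d) :=
  Seminorm.of (fun Φ => ⨆ y, weightedY s r l m k Φ y)
    (fun Φ Ψ => by
      have : Nonempty (Y d) := ⟨(radialProj 0, 0, 0)⟩
      refine ciSup_le fun y => (weightedY_add_le s r l m k Φ.2.1 Ψ.2.1 y).trans ?_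
      exact add_le_add (le_ciSup (Φ.2.2 s r l m k) y) (le_ciSup (Ψ.2.2 s r l m k) y))
    (fun c Φ => by
      have e : weightedY s r l m k (c • Φ : SchwartzY d) =
          fun y => ‖c‖ * weightedY s r l m k Φ y :=
        funext fun y => weightedY_smul s r l m k c Φ.2.1 y
      rw [e, Real.mul_iSup_of_nonneg (norm_nonneg c)])

/-- The family of all the seminorms `ρ_{s,r}^{l,m,k}`, with index `(s, r, l, m, k)`. -/
def seminormFamilyY (d : ℕ) :
    SeminormFamily ℂ (SchwartzY d) (ℕ × ℕ × (Fin (d + 1) → ℕ) × ℕ × ℕ) :=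
  fun i => seminormY i.1 i.2.1 i.2.2.1 i.2.2.2.1 i.2.2.2.2

/-- The topology of `𝒮(𝕐²ⁿ)`, defined by the seminorms `ρ_{s,r}^{l,m,k}`. -/
instance (d : ℕ) : TopologicalSpace (SchwartzY d) :=
  (seminormFamilyY d).moduleFilterBasis.topology

lemma withSeminormsY (d : ℕ) : WithSeminorms (seminormFamilyY d) := ⟨rfl⟩

/-- The space `𝒮'(ℝⁿ)` of tempered distributions: continuous linear functionals on `𝒮(ℝⁿ)`. -/
abbrev TemperedDual (d : ℕ) : Type := 𝓢(E d, ℂ) →L[ℂ] ℂ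

/-- The space `𝒮'(𝕐²ⁿ)`: continuous linear functionals on `𝒮(𝕐²ⁿ)`. -/
abbrev SchwartzYDual (d : ℕ) : Type := SchwartzY d →L[ℂ] ℂ

/-! ### The transform and its synthesis operator on functions -/

/-- The one-dimensional kernel `C_α exp(i ((x² + ξ²)/2 · cot α - x ξ csc α))` with
`C_α = √((1 - i cot α)/(2π))` (principal square root), for `α` not a multiple of `π`. -/
def kernel1 (α x ξ : ℝ) : ℂ :=
  ((1 - Complex.I * (Real.cot α : ℂ)) / (2 * (Real.pi : ℂ))) ^ (1 / 2 : ℂ) *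
    Complex.exp (Complex.I *
      (((x ^ 2 + ξ ^ 2) / 2 * Real.cot α - x * ξ * (Real.sin α)⁻¹ : ℝ) : ℂ))

/-- The kernel `K_α(x, ξ)` on `ℝⁿ × ℝⁿ`. -/
def kernel {d : ℕ} (α : Fin (d + 1) → ℝ) (x ξ : E d) : ℂ :=
  ∏ k, kernel1 (α k) (x k) (ξ k)

/-- The directional short-time fractional Fourier transform
`DS_ψ^α f (u, b, a) = ∫ f(x) conj(ψ(u·x - b)) K_α(x, a) dx` of a function `f`. -/
def dstfrft {d : ℕ} (α : Fin (d + 1) → ℝ) (ψ : ℝ → ℂ) (f : E d → ℂ) (y : Y d) : ℂ :=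
  ∫ x : E d, f x * conj (ψ (⟪(y.1 : E d), x⟫_ℝ - y.2.1)) * kernel α x y.2.2

/-- The synthesis operator
`(DS_ψ^α)^* Φ (x) = ∫ ∫ ∫ Φ(u, b, a) ψ(x·u - b) K_{-α}(x, a) db da du` on functions. -/
def synthesis {d : ℕ} (α : Fin (d + 1) → ℝ) (ψ : ℝ → ℂ) (Φ : Y d → ℂ) (x : E d) : ℂ :=
  ∫ u : Sph d, ∫ a : E d, ∫ b : ℝ,
    Φ (u, b, a) * ψ (⟪x, (u : E d)⟫_ℝ - b) * kernel (-α) x a ∂volume ∂volume ∂(sphereMeasure d)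

/-! ### The transform and its synthesis operator on distributions -/

/-- `T : 𝒮'(ℝⁿ) → 𝒮'(𝕐²ⁿ)` is the distributional transform `DS_ψ^α`: for every
`Φ ∈ 𝒮(𝕐²ⁿ)` the function `conj ((DS_ψ^α)^* (conj Φ))` belongs to `𝒮(ℝⁿ)`, and
`⟨T f, Φ⟩ = ⟨f, conj ((DS_ψ^α)^* (conj Φ))⟩` for every `f ∈ 𝒮'(ℝⁿ)`. -/
def IsDistDSTFRFT {d : ℕ} (α : Fin (d + 1) → ℝ) (ψ : 𝓢(ℝ, ℂ))
    (T : TemperedDual d →ₗ[ℂ] SchwartzYDual d) : Prop :=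
  ∀ Φ : SchwartzY d, ∃ g : 𝓢(E d, ℂ),
    (∀ x, g x = conj (synthesis α ψ (fun y => conj (Φ y)) x)) ∧
    ∀ f : TemperedDual d, T f Φ = f g

/-- `S : 𝒮'(𝕐²ⁿ) → 𝒮'(ℝⁿ)` is the distributional synthesis operator `(DS_ψ^α)^*`: for every
`φ ∈ 𝒮(ℝⁿ)` the function `conj (DS_ψ^α (conj φ))` belongs to `𝒮(𝕐²ⁿ)`, and
`⟨S F, φ⟩ = ⟨F, conj (DS_ψ^α (conj φ))⟩` for every `F ∈ 𝒮'(𝕐²ⁿ)`. -/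
def IsDistSynthesis {d : ℕ} (α : Fin (d + 1) → ℝ) (ψ : 𝓢(ℝ, ℂ))
    (S : SchwartzYDual d →ₗ[ℂ] TemperedDual d) : Prop :=
  ∀ φ : 𝓢(E d, ℂ), ∃ G : SchwartzY d,
    (∀ y, G y = conj (dstfrft α ψ (fun x => conj (φ x)) y)) ∧
    ∀ F : SchwartzYDual d, S F φ = F G

/-- The `L²` inner product `(η, ψ) = ∫ η conj(ψ)`. -/
def windowInner (η ψ : 𝓢(ℝ, ℂ)) : ℂ := ∫ t : ℝ, η t * conj (ψ t)

/-- `η` is a synthesis window for `ψ`. -/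
def IsSynthesisWindow (η ψ : 𝓢(ℝ, ℂ)) : Prop := windowInner η ψ ≠ 0

end DSTFRFT

end

noncomputable section

namespace DSTFRFT

/-! Both distributional operators are transposes. Complex conjugation turns `K_α` into `K_{-α}`, so
the test-function maps in the duality formulas are `A φ = J (-α) φ η`, restricted to the sphere in
the first variable, and `B Φ = G α (conj ψ) Φ`. Once `A : 𝒮(ℝⁿ) → 𝒮(𝕐²ⁿ)` and `B : 𝒮(𝕐²ⁿ) → 𝒮(ℝⁿ)`
are known to be continuous, the operators are `F ↦ F ∘ A` and `f ↦ f ∘ B`. Uniqueness is then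
immediate, and the theorem reduces to `B (A φ) = (η, ψ) φ`.

This identity is `G_conjT_analysis`. For fixed `(u, b)` the function `A φ (u, b, ·)` is the
fractional Fourier transform of `φ · η(u·x - b)`. Integrating it against `K_α(x, a)` in `a` gives
that product back (`kernel_inversion`, which is Fourier inversion after chirps and a diagonal
rescaling are removed). The factor `conj ψ(u·x - b)` is then integrated in `b` to give `(η, ψ)`,
whatever `u` is, and the sphere has total mass one.

Continuity rests on an algebra of operators. Derivatives of the kernel are multiplications by
coordinates, so integration by parts in `x` turns multiplication of `J` by `a_k` into operations on
`φ` and the window, and `b = u·x - (u·x - b)` does the same for `b` (`mulA_J`, `mulB_J`). Hence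
weighted derivatives of `A φ` are controlled by finite sums of transforms of the same type
(`Generated`), each bounded by a continuous seminorm of `φ`. For `B` the parts are integrated in
`a`: multiplication by `x_k` becomes `∂_{a_k}` and `a_k` acting on `Φ` (`mulX_G`), while derivatives
in `x` fall on the window and the kernel (`GeneratedX`, `IsStable`). The condition `sin α_k ≠ 0` is
what allows the multiplication rules to be solved for `a_k` and `x_k`. -/

/-! ### The kernel -/

/-- The normalizing constant of the kernel. -/
def kernelConst {d : ℕ} (α : Fin (d + 1) → ℝ) : ℂ :=
  ∏ k, ((1 - Complex.I * (Real.cot (α k) : ℂ)) / (2 * (Real.pi : ℂ))) ^ (1 / 2 : ℂ)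

/-- The phase of the kernel. -/
def phase {d : ℕ} (α : Fin (d + 1) → ℝ) (x a : E d) : ℝ :=
  ∑ k, ((x k ^ 2 + a k ^ 2) / 2 * Real.cot (α k) - x k * a k * (Real.sin (α k))⁻¹)

lemma kernel_eq {d : ℕ} (α : Fin (d + 1) → ℝ) (x a : E d) :
    kernel α x a = kernelConst α * Complex.exp (Complex.I * (phase α x a : ℂ)) := by
  simp only [kernel, kernel1, kernelConst, phase, Finset.prod_mul_distrib]
  rw [Complex.ofReal_sum, Finset.mul_sum, Complex.exp_sum]

lemma phase_comm {d : ℕ} (α : Fin (d + 1) → ℝ) (x a : E d) : phase α x a = phase α a x := by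
  unfold phase
  exact Finset.sum_congr rfl fun k _ => by ring

/-- By this symmetry one derivative formula serves both variables. -/
lemma kernel_comm {d : ℕ} (α : Fin (d + 1) → ℝ) (x a : E d) : kernel α x a = kernel α a x := by
  rw [kernel_eq, kernel_eq, phase_comm]

/-- The phase is real, so the exponential is unimodular. All later domination arguments use this. -/
lemma norm_kernel {d : ℕ} (α : Fin (d + 1) → ℝ) (x a : E d) :
    ‖kernel α x a‖ = ‖kernelConst α‖ := by
  rw [kernel_eq, norm_mul, mul_comm Complex.I, Complex.norm_exp_ofReal_mul_I, mul_one]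

/-- The coordinate `k` as a complex valued real linear functional. -/
def coordC {d : ℕ} (k : Fin (d + 1)) : E d →L[ℝ] ℂ :=
  Complex.ofRealCLM.comp (EuclideanSpace.proj k)

@[simp] lemma coordC_apply {d : ℕ} (k : Fin (d + 1)) (x : E d) : coordC k x = (x k : ℂ) := rfl

lemma hasFDerivAt_phase {d : ℕ} (α : Fin (d + 1) → ℝ) (x a : E d) :
    HasFDerivAt (fun a => phase α x a)
      (∑ k, (a k * Real.cot (α k) - x k * (Real.sin (α k))⁻¹) •
        (EuclideanSpace.proj k : E d →L[ℝ] ℝ)) a := by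
  unfold phase
  refine HasFDerivAt.fun_sum fun k _ => ?_
  have h : HasFDerivAt (fun a : E d => a k) (EuclideanSpace.proj k : E d →L[ℝ] ℝ) a :=
    (EuclideanSpace.proj k : E d →L[ℝ] ℝ).hasFDerivAt
  have h1 : HasDerivAt (fun t : ℝ => (x k ^ 2 + t ^ 2) / 2 * Real.cot (α k) -
      x k * t * (Real.sin (α k))⁻¹) (a k * Real.cot (α k) - x k * (Real.sin (α k))⁻¹) (a k) := by
    have := (((((hasDerivAt_id (a k)).pow 2).const_add (x k ^ 2)).div_const 2).mul_const
      (Real.cot (α k))).sub (((hasDerivAt_id (a k)).const_mul (x k)).mul_const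
        (Real.sin (α k))⁻¹)
    convert! this using 1
    simp
  exact h1.comp_hasFDerivAt a h

/-- Differentiating the kernel only multiplies it by a linear function of the coordinates; this is
the source of all the multiplication rules below. -/
lemma hasFDerivAt_kernel {d : ℕ} (α : Fin (d + 1) → ℝ) (x a : E d) :
    HasFDerivAt (fun a => kernel α x a)
      (∑ k, (Complex.I * ((a k * Real.cot (α k) - x k * (Real.sin (α k))⁻¹ : ℝ) : ℂ) *
        kernel α x a) • coordC k) a := by
  simp only [kernel_eq]
  have h := ((Complex.ofRealCLM.hasFDerivAt.comp a (hasFDerivAt_phase α x a)).const_mul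
    Complex.I).cexp.const_mul (kernelConst α)
  convert! h using 1
  ext v
  simp only [sum_apply, smul_apply, coordC_apply,
    ContinuousLinearMap.comp_apply, smul_eq_mul, Finset.mul_sum, map_sum, Function.comp_apply,
    Complex.ofRealCLM_apply, PiLp.proj_apply]
  refine Finset.sum_congr rfl fun k _ => ?_
  push_cast
  ring

lemma continuous_kernel {d : ℕ} (α : Fin (d + 1) → ℝ) :
    Continuous (fun p : E d × E d => kernel α p.1 p.2) := by
  simp only [kernel_eq, phase]
  fun_prop

/-- The principal root commutes with conjugation off the negative axis, and the radicand has real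
part `1 / (2π) > 0`. -/
lemma conj_sqrt_const (c : ℝ) :
    conj (((1 - Complex.I * (c : ℂ)) / (2 * (Real.pi : ℂ))) ^ (1 / 2 : ℂ)) =
      ((1 - Complex.I * ((-c : ℝ) : ℂ)) / (2 * (Real.pi : ℂ))) ^ (1 / 2 : ℂ) := by
  have hb : (1 - Complex.I * ((-c : ℝ) : ℂ)) / (2 * (Real.pi : ℂ)) =
      conj ((1 - Complex.I * (c : ℂ)) / (2 * (Real.pi : ℂ))) := by
    simp [map_div₀, Complex.conj_ofNat]
  have hre : 0 < ((1 - Complex.I * ((-c : ℝ) : ℂ)) / (2 * (Real.pi : ℂ))).re := by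
    have e : (2 * (Real.pi : ℂ)) = ((2 * Real.pi : ℝ) : ℂ) := by push_cast; rfl
    have : ((1 - Complex.I * ((-c : ℝ) : ℂ)) / (2 * (Real.pi : ℂ))).re = 1 / (2 * Real.pi) := by
      rw [e, Complex.div_ofReal_re]
      simp
    rw [this]; positivity
  have h3 : conj (1 / 2 : ℂ) = 1 / 2 := by simp [Complex.conj_ofNat]
  have h2 := Complex.cpow_conj ((1 - Complex.I * ((-c : ℝ) : ℂ)) / (2 * (Real.pi : ℂ)))
    (1 / 2) (fun h => by linarith [(Complex.arg_eq_pi_iff.1 h).1])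
  rw [h3] at h2
  rw [h2, hb, Complex.conj_conj]

lemma cot_neg (t : ℝ) : Real.cot (-t) = -Real.cot t := by
  rw [Real.cot_eq_cos_div_sin, Real.cot_eq_cos_div_sin]; simp [div_neg]

lemma conj_kernelConst {d : ℕ} (α : Fin (d + 1) → ℝ) :
    conj (kernelConst α) = kernelConst (-α) := by
  simp only [kernelConst, map_prod, Pi.neg_apply, cot_neg]
  exact Finset.prod_congr rfl fun k _ => conj_sqrt_const _

lemma phase_neg {d : ℕ} (α : Fin (d + 1) → ℝ) (x a : E d) : phase (-α) x a = -phase α x a := by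
  simp only [phase, Pi.neg_apply, cot_neg, Real.sin_neg, ← Finset.sum_neg_distrib]
  exact Finset.sum_congr rfl fun k _ => by rw [inv_neg]; ring

lemma conj_kernel {d : ℕ} (α : Fin (d + 1) → ℝ) (x a : E d) :
    conj (kernel α x a) = kernel (-α) x a := by
  rw [kernel_eq, kernel_eq, map_mul, conj_kernelConst, ← Complex.exp_conj, map_mul,
    Complex.conj_I, Complex.conj_ofReal, phase_neg]
  push_cast
  ring_nf

/-! ### Multiplication and differentiation operators on Schwartz functions -/

/-- Multiplication by the coordinate `k`. -/
def mulX {d : ℕ} (k : Fin (d + 1)) : 𝓢(E d, ℂ) →L[ℂ] 𝓢(E d, ℂ) :=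
  SchwartzMap.smulLeftCLM ℂ (fun x : E d => coordC k x)

@[simp] lemma mulX_apply {d : ℕ} (k : Fin (d + 1)) (φ : 𝓢(E d, ℂ)) (x : E d) :
    mulX k φ x = (x k : ℂ) * φ x := by
  unfold mulX
  rw [SchwartzMap.smulLeftCLM_apply_apply (coordC k).hasTemperateGrowth]
  simp

/-- Multiplication by the variable. -/
def mulT (θ : 𝓢(ℝ, ℂ)) : 𝓢(ℝ, ℂ) := SchwartzMap.smulLeftCLM ℂ (fun t : ℝ => Complex.ofRealCLM t) θ

@[simp] lemma mulT_apply (θ : 𝓢(ℝ, ℂ)) (t : ℝ) : mulT θ t = (t : ℂ) * θ t := by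
  unfold mulT
  rw [SchwartzMap.smulLeftCLM_apply_apply Complex.ofRealCLM.hasTemperateGrowth]
  simp

/-- The partial derivative in the coordinate `k`. -/
def derivX {d : ℕ} (k : Fin (d + 1)) : 𝓢(E d, ℂ) →L[ℂ] 𝓢(E d, ℂ) :=
  LineDeriv.lineDerivOpCLM ℂ 𝓢(E d, ℂ) (EuclideanSpace.single k (1 : ℝ))

lemma derivX_apply {d : ℕ} (k : Fin (d + 1)) (φ : 𝓢(E d, ℂ)) (x : E d) :
    derivX k φ x = fderiv ℝ φ x (EuclideanSpace.single k 1) :=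
  SchwartzMap.lineDerivOp_apply_eq_fderiv _ _ _

/-- The derivative of a Schwartz function on the line. -/
def derivT (θ : 𝓢(ℝ, ℂ)) : 𝓢(ℝ, ℂ) := SchwartzMap.derivCLM ℂ ℂ θ

lemma hasDerivAt_derivT (θ : 𝓢(ℝ, ℂ)) (t : ℝ) : HasDerivAt θ (derivT θ t) t := by
  simpa [derivT] using θ.hasDerivAt t

/-- Complex conjugation of a Schwartz function on the line. -/
def conjT (θ : 𝓢(ℝ, ℂ)) : 𝓢(ℝ, ℂ) :=
  SchwartzMap.postcompCLM (𝕜 := ℝ) (Complex.conjCLE : ℂ →L[ℝ] ℂ) θ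

@[simp] lemma conjT_apply (θ : 𝓢(ℝ, ℂ)) (t : ℝ) : conjT θ t = conj (θ t) := by
  simp [conjT, SchwartzMap.postcompCLM_apply]

lemma exists_bound (θ : 𝓢(ℝ, ℂ)) : ∃ C, 0 ≤ C ∧ ∀ t, ‖θ t‖ ≤ C :=
  ⟨SchwartzMap.seminorm ℝ 0 0 θ, apply_nonneg _ _, fun t => SchwartzMap.norm_le_seminorm ℝ θ t⟩

/-- A vector is the sum of its coordinates. -/
lemma eq_sum_single {d : ℕ} (v : E d) :
    v = ∑ k, v k • (EuclideanSpace.single k (1 : ℝ) : E d) := by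
  ext i
  simp [Finset.sum_apply, Pi.single_apply]

lemma inner_eq_sum {d : ℕ} (v x : E d) : ⟪v, x⟫_ℝ = ∑ k, v k * x k := by
  rw [PiLp.inner_apply]
  exact Finset.sum_congr rfl fun k _ => by simp [mul_comm]

/-! ### The transform as a function on `ℝⁿ × ℝ × ℝⁿ` -/

/-- The space `ℝⁿ × ℝ × ℝⁿ` of triples `(v, b, a)`. -/
abbrev Q (d : ℕ) : Type := E d × ℝ × E d

/-- The coordinate `v_k` as a covector. -/
def covV {d : ℕ} (k : Fin (d + 1)) : Q d →L[ℝ] ℂ :=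
  (coordC k).comp (ContinuousLinearMap.fst ℝ (E d) (ℝ × E d))

/-- The coordinate `b` as a covector. -/
def covB {d : ℕ} : Q d →L[ℝ] ℂ :=
  Complex.ofRealCLM.comp ((ContinuousLinearMap.fst ℝ ℝ (E d)).comp
    (ContinuousLinearMap.snd ℝ (E d) (ℝ × E d)))

/-- The coordinate `a_k` as a covector. -/
def covA {d : ℕ} (k : Fin (d + 1)) : Q d →L[ℝ] ℂ :=
  (coordC k).comp ((ContinuousLinearMap.snd ℝ ℝ (E d)).comp
    (ContinuousLinearMap.snd ℝ (E d) (ℝ × E d)))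

@[simp] lemma covV_apply {d : ℕ} (k : Fin (d + 1)) (q : Q d) : covV k q = (q.1 k : ℂ) := rfl
@[simp] lemma covB_apply {d : ℕ} (q : Q d) : covB q = (q.2.1 : ℂ) := rfl
@[simp] lemma covA_apply {d : ℕ} (k : Fin (d + 1)) (q : Q d) : covA k q = (q.2.2 k : ℂ) := rfl

/-- The integrand of the transform. -/
def integrandJ {d : ℕ} (α : Fin (d + 1) → ℝ) (φ : 𝓢(E d, ℂ)) (θ : 𝓢(ℝ, ℂ)) (q : Q d) (x : E d) :
    ℂ := φ x * θ (⟪q.1, x⟫_ℝ - q.2.1) * kernel α x q.2.2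

/-- The transform of `φ` with window `conj θ`, as a function of `(v, b, a) ∈ ℝⁿ × ℝ × ℝⁿ`. -/
def J {d : ℕ} (α : Fin (d + 1) → ℝ) (φ : 𝓢(E d, ℂ)) (θ : 𝓢(ℝ, ℂ)) (q : Q d) : ℂ :=
  ∫ x, integrandJ α φ θ q x

lemma continuous_integrandJ {d : ℕ} (α : Fin (d + 1) → ℝ) (φ : 𝓢(E d, ℂ)) (θ : 𝓢(ℝ, ℂ))
    (q : Q d) : Continuous (integrandJ α φ θ q) := by
  unfold integrandJ
  refine (φ.continuous.mul (θ.continuous.comp (by fun_prop))).mul ?_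
  exact (continuous_kernel α).comp (f := fun x : E d => (x, q.2.2)) (by fun_prop)

/-- The window is bounded and the kernel has constant modulus, so the constant depends neither on
`φ` nor on the point `q`. -/
lemma exists_norm_integrandJ_le {d : ℕ} (α : Fin (d + 1) → ℝ) (θ : 𝓢(ℝ, ℂ)) :
    ∃ C, 0 ≤ C ∧ ∀ (φ : 𝓢(E d, ℂ)) q x, ‖integrandJ α φ θ q x‖ ≤ C * ‖φ x‖ := by
  obtain ⟨C, hC, h⟩ := exists_bound θ
  refine ⟨C * ‖kernelConst α‖, by positivity, fun φ q x => ?_⟩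
  rw [integrandJ, norm_mul, norm_mul, norm_kernel]
  have := h (⟪q.1, x⟫_ℝ - q.2.1)
  calc ‖φ x‖ * ‖θ (⟪q.1, x⟫_ℝ - q.2.1)‖ * ‖kernelConst α‖ ≤ ‖φ x‖ * C * ‖kernelConst α‖ := by
        gcongr
    _ = _ := by ring

lemma integrable_integrandJ {d : ℕ} (α : Fin (d + 1) → ℝ) (φ : 𝓢(E d, ℂ)) (θ : 𝓢(ℝ, ℂ))
    (q : Q d) : Integrable (integrandJ α φ θ q) := by
  obtain ⟨C, -, h⟩ := exists_norm_integrandJ_le (d := d) α θ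
  exact (φ.integrable.norm.const_mul C).mono' (continuous_integrandJ α φ θ q).aestronglyMeasurable
    (.of_forall fun x => h φ q x)

/-- The derivative of the integrand in `(v, b, a)`. -/
def derivIntegrandJ {d : ℕ} (α : Fin (d + 1) → ℝ) (φ : 𝓢(E d, ℂ)) (θ : 𝓢(ℝ, ℂ)) (q : Q d)
    (x : E d) : Q d →L[ℝ] ℂ :=
  (∑ k, integrandJ α (mulX k φ) (derivT θ) q x • covV k) - integrandJ α φ (derivT θ) q x • covB +
    ∑ k, (Complex.I * ((q.2.2 k * Real.cot (α k) : ℝ) : ℂ) * integrandJ α φ θ q x -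
      Complex.I * ((Real.sin (α k))⁻¹ : ℝ) * integrandJ α (mulX k φ) θ q x) • covA k

lemma hasFDerivAt_inner_sub {d : ℕ} (q : Q d) (x : E d) :
    HasFDerivAt (fun q : Q d => ⟪q.1, x⟫_ℝ - q.2.1)
      ((∑ k, x k • (EuclideanSpace.proj k : E d →L[ℝ] ℝ).comp
        (ContinuousLinearMap.fst ℝ (E d) (ℝ × E d))) - (ContinuousLinearMap.fst ℝ ℝ (E d)).comp
    (ContinuousLinearMap.snd ℝ (E d) (ℝ × E d))) q := by
  have h := ((∑ k, x k • (EuclideanSpace.proj k : E d →L[ℝ] ℝ).comp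
        (ContinuousLinearMap.fst ℝ (E d) (ℝ × E d))) - (ContinuousLinearMap.fst ℝ ℝ (E d)).comp
    (ContinuousLinearMap.snd ℝ (E d) (ℝ × E d))).hasFDerivAt (x := q)
  convert! h using 1
  funext q
  simp [inner_eq_sum, mul_comm]

lemma hasFDerivAt_integrandJ {d : ℕ} (α : Fin (d + 1) → ℝ) (φ : 𝓢(E d, ℂ)) (θ : 𝓢(ℝ, ℂ))
    (q : Q d) (x : E d) :
    HasFDerivAt (fun q => integrandJ α φ θ q x) (derivIntegrandJ α φ θ q x) q := by
  have h1 := ((hasDerivAt_derivT θ (⟪q.1, x⟫_ℝ - q.2.1)).hasFDerivAt.comp q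
    (hasFDerivAt_inner_sub q x)).const_mul (φ x)
  have h2 : HasFDerivAt (fun q : Q d => kernel α x q.2.2) _ q :=
    HasFDerivAt.comp (g := fun a => kernel α x a) (f := fun q : Q d => q.2.2) q
      (hasFDerivAt_kernel α x q.2.2) ((hasFDerivAt_snd (𝕜 := ℝ) (p := q)).snd)
  convert! h1.mul h2 using 1
  ext w
  · simp [derivIntegrandJ, integrandJ, Finset.mul_sum]
    refine Finset.sum_congr rfl fun k _ => ?_
    ring
  · simp [derivIntegrandJ, integrandJ]
    ring
  · simp [derivIntegrandJ, integrandJ, Finset.mul_sum]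
    refine Finset.sum_congr rfl fun k _ => ?_
    ring

/-- The derivative of the transform in `(v, b, a)`. -/
def derivJ {d : ℕ} (α : Fin (d + 1) → ℝ) (φ : 𝓢(E d, ℂ)) (θ : 𝓢(ℝ, ℂ)) (q : Q d) :
    Q d →L[ℝ] ℂ :=
  (∑ k, J α (mulX k φ) (derivT θ) q • covV k) - J α φ (derivT θ) q • covB +
    ∑ k, (Complex.I * ((q.2.2 k * Real.cot (α k) : ℝ) : ℂ) * J α φ θ q -
      Complex.I * ((Real.sin (α k))⁻¹ : ℝ) * J α (mulX k φ) θ q) • covA k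

lemma integral_derivIntegrandJ {d : ℕ} (α : Fin (d + 1) → ℝ) (φ : 𝓢(E d, ℂ)) (θ : 𝓢(ℝ, ℂ))
    (q : Q d) : ∫ x, derivIntegrandJ α φ θ q x = derivJ α φ θ q := by
  unfold derivIntegrandJ derivJ J
  have hi := fun φ θ => integrable_integrandJ α φ θ q
  rw [integral_add, integral_sub, integral_finsetSum, integral_finsetSum]
  · simp_rw [integral_smul_const]
    congr 1
    refine Finset.sum_congr rfl fun k _ => ?_
    rw [integral_sub ((hi _ _).const_mul _) ((hi _ _).const_mul _), integral_const_mul,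
      integral_const_mul]
  · exact fun k _ => (((hi _ _).const_mul _).sub ((hi _ _).const_mul _)).smul_const _
  · exact fun k _ => (hi _ _).smul_const _
  · exact integrable_finsetSum _ fun k _ => (hi _ _).smul_const _
  · exact (hi _ _).smul_const _
  · exact (integrable_finsetSum _ fun k _ => (hi _ _).smul_const _).sub ((hi _ _).smul_const _)
  · exact integrable_finsetSum _
      fun k _ => (((hi _ _).const_mul _).sub ((hi _ _).const_mul _)).smul_const _

/-- Differentiation under the integral sign; the factors `x_k` that appear are absorbed by the decay
of `φ`. -/
lemma hasFDerivAt_J {d : ℕ} (α : Fin (d + 1) → ℝ) (φ : 𝓢(E d, ℂ)) (θ : 𝓢(ℝ, ℂ)) (q : Q d) :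
    HasFDerivAt (J α φ θ) (derivJ α φ θ q) q := by
  obtain ⟨C, hC, hθ⟩ := exists_norm_integrandJ_le (d := d) α θ
  obtain ⟨C', hC', hθ'⟩ := exists_norm_integrandJ_le (d := d) α (derivT θ)
  rw [← integral_derivIntegrandJ]
  refine hasFDerivAt_integral_of_dominated_of_fderiv_le (Metric.ball_mem_nhds q one_pos)
    -- The only coefficient varying with the point is `a_k`, and `|a_k| ≤ ‖q‖ + 1` on the unit ball
    -- around `q`.
    (bound := fun x => (∑ k, C' * ‖mulX k φ x‖ * ‖(covV k : Q d →L[ℝ] ℂ)‖) +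
      C' * ‖φ x‖ * ‖(covB : Q d →L[ℝ] ℂ)‖ +
      ∑ k, (((‖q‖ + 1) * |Real.cot (α k)|) * (C * ‖φ x‖) +
        |(Real.sin (α k))⁻¹| * (C * ‖mulX k φ x‖)) * ‖(covA k : Q d →L[ℝ] ℂ)‖)
    (.of_forall fun q => (continuous_integrandJ α φ θ q).aestronglyMeasurable)
    (integrable_integrandJ α φ θ q) ?_ (.of_forall fun x q' hq' => ?_) ?_
    (.of_forall fun x q' _ => hasFDerivAt_integrandJ α φ θ q' x)
  · refine Continuous.aestronglyMeasurable ?_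
    unfold derivIntegrandJ
    have hc := fun φ θ => continuous_integrandJ α φ θ q
    fun_prop
  · have hq : ∀ k, |q'.2.2 k| ≤ ‖q‖ + 1 := fun k => by
      have h1 : |q'.2.2 k| ≤ ‖q'.2.2‖ := PiLp.norm_apply_le q'.2.2 k
      have h2 : ‖q'.2.2‖ ≤ ‖q'‖ := (norm_snd_le q'.2).trans (norm_snd_le q')
      have h3 : ‖q' - q‖ < 1 := by simpa [dist_eq_norm] using hq'
      have h4 : ‖q'‖ ≤ ‖q‖ + ‖q' - q‖ := by
        simpa using norm_add_le q (q' - q)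
      linarith
    refine (norm_add_le _ _).trans (add_le_add ((norm_sub_le _ _).trans (add_le_add
      ((norm_sum_le _ _).trans (Finset.sum_le_sum fun k _ => ?_)) ?_))
      ((norm_sum_le _ _).trans (Finset.sum_le_sum fun k _ => ?_)))
    · rw [norm_smul]; gcongr; exact hθ' _ _ _
    · rw [norm_smul]; gcongr; exact hθ' _ _ _
    · rw [norm_smul]
      gcongr
      refine (norm_sub_le _ _).trans (add_le_add ?_ ?_)
      · rw [norm_mul, norm_mul, Complex.norm_I, one_mul, Complex.norm_real, Real.norm_eq_abs,
          abs_mul]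
        gcongr
        · exact hq k
        · exact hθ _ _ _
      · rw [norm_mul, norm_mul, Complex.norm_I, one_mul, Complex.norm_real, Real.norm_eq_abs]
        gcongr
        exact hθ _ _ _
  · have hi := fun φ : 𝓢(E d, ℂ) => (φ.integrable (μ := volume)).norm
    refine ((integrable_finsetSum _ fun k _ => ((hi _).const_mul _).mul_const _).add
      (((hi _).const_mul _).mul_const _)).add (integrable_finsetSum _ fun k _ => ?_)
    exact ((((hi _).const_mul _).const_mul _).add (((hi _).const_mul _).const_mul _)).mul_const _

/-- The derivative is a combination of transforms with other data `(φ, θ)` and coefficients linear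
in `a`, so the induction must run over all data at once. -/
lemma contDiff_J {d : ℕ} (α : Fin (d + 1) → ℝ) (φ : 𝓢(E d, ℂ)) (θ : 𝓢(ℝ, ℂ)) :
    ContDiff ℝ ∞ (J α φ θ) := by
  rw [contDiff_infty]
  intro n
  induction n generalizing φ θ with
  | zero =>
    exact contDiff_zero.2 (continuous_iff_continuousAt.2
      fun q => (hasFDerivAt_J α φ θ q).continuousAt)
  | succ n ih =>
    have e : fderiv ℝ (J α φ θ) = derivJ α φ θ := funext fun q => (hasFDerivAt_J α φ θ q).fderiv
    push_cast
    rw [contDiff_succ_iff_fderiv]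
    refine ⟨fun q => (hasFDerivAt_J α φ θ q).differentiableAt, by simp, ?_⟩
    rw [e]
    unfold derivJ
    have hA : ∀ k, ContDiff ℝ n (fun q : Q d => ((q.2.2 k * Real.cot (α k) : ℝ) : ℂ)) := fun k => by
      have : (fun q : Q d => ((q.2.2 k * Real.cot (α k) : ℝ) : ℂ)) =
          fun q => covA k q * (Real.cot (α k) : ℂ) := by funext q; simp
      rw [this]
      exact (covA k).contDiff.mul contDiff_const
    refine ((ContDiff.sum fun k _ => (ih _ _).smul contDiff_const).sub
      ((ih _ _).smul contDiff_const)).add (ContDiff.sum fun k _ => ContDiff.smul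
        (((contDiff_const.mul (hA k)).mul (ih _ _)).sub (contDiff_const.mul (ih _ _)))
        contDiff_const)

/-! ### Integration by parts and multiplication of the transform by `a_k` and `b`. -/

/-- Integration by parts against the constant `1`: only its products with `W` and `W'` have to be
integrable. -/
lemma integral_fderiv_eq_zero {d : ℕ} {W W' : E d → ℂ} (v : E d)
    (hW : ∀ x, HasLineDerivAt ℝ W (W' x) x v) (hi : Integrable W) (hi' : Integrable W') :
    ∫ x, W' x = 0 := by
  have := integral_bilinear_hasLineDerivAt_right_eq_neg_left_of_integrable (μ := volume)
    (f := fun _ : E d => (1 : ℂ)) (f' := fun _ => 0) (g := W) (g' := W') (v := v)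
    (B := ContinuousLinearMap.mul ℝ ℂ) (by simp) (by simpa using hi') (by simpa using hi)
    (fun x _ => by simpa using (hasFDerivAt_const (1 : ℂ) x).hasLineDerivAt v)
    (fun x _ => hW x)
  simpa using this

lemma sum_smul_coordC_single {d : ℕ} (c : Fin (d + 1) → ℂ) (k : Fin (d + 1)) :
    (∑ j, c j • coordC j : E d →L[ℝ] ℂ) (EuclideanSpace.single k 1) = c k := by
  rw [sum_apply, Finset.sum_eq_single k]
  · simp
  · intro j _ hj
    simp [hj]
  · simp

/-- Multiplication of the transform by `a_k`. -/
lemma mulA_J {d : ℕ} {α : Fin (d + 1) → ℝ} (hα : ∀ k, Real.sin (α k) ≠ 0) (k : Fin (d + 1))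
    (φ : 𝓢(E d, ℂ)) (θ : 𝓢(ℝ, ℂ)) (q : Q d) :
    (q.2.2 k : ℂ) * J α φ θ q = -Complex.I * (Real.sin (α k) : ℂ) *
      (J α (derivX k φ) θ q + (q.1 k : ℂ) * J α φ (derivT θ) q) +
      (Real.sin (α k) * Real.cot (α k) : ℝ) * J α (mulX k φ) θ q := by
  have hi := fun φ θ => integrable_integrandJ α φ θ q
  have hline : ∀ x, HasLineDerivAt ℝ (integrandJ α φ θ q)
      (integrandJ α (derivX k φ) θ q x + (q.1 k : ℂ) * integrandJ α φ (derivT θ) q x +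
        (Complex.I * (Real.cot (α k) : ℝ) * integrandJ α (mulX k φ) θ q x -
        Complex.I * ((q.2.2 k * (Real.sin (α k))⁻¹ : ℝ) : ℂ) * integrandJ α φ θ q x)) x
      (EuclideanSpace.single k 1) := by
    intro x
    have h1 : HasFDerivAt (fun x : E d => θ (⟪q.1, x⟫_ℝ - q.2.1)) _ x :=
      (hasDerivAt_derivT θ (⟪q.1, x⟫_ℝ - q.2.1)).hasFDerivAt.comp x
        ((innerSL ℝ q.1).hasFDerivAt.sub_const q.2.1)
    have h2 := hasFDerivAt_kernel α q.2.2 x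
    simp only [kernel_comm α q.2.2] at h2
    have h3 := (((φ.hasFDerivAt x).mul h1).mul h2).hasLineDerivAt (EuclideanSpace.single k 1)
    convert! h3 using 1
    simp only [add_apply, smul_apply, sum_smul_coordC_single]
    simp [integrandJ, derivX_apply, EuclideanSpace.inner_single_right]
    ring
  -- The `x_k`-derivative of the integrand has integral zero. The kernel contributes `i (x_k cot α_k
  -- - a_k / sin α_k)`, and this is where `a_k` enters.
  have h0 := integral_fderiv_eq_zero _ hline (hi φ θ)
    (((hi _ _).add ((hi _ _).const_mul _)).add (((hi _ _).const_mul _).sub ((hi _ _).const_mul _)))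
  rw [integral_add, integral_add, integral_sub] at h0
  rotate_left
  · exact (hi _ _).const_mul _
  · exact (hi _ _).const_mul _
  · exact hi _ _
  · exact (hi _ _).const_mul _
  · exact (hi _ _).add ((hi _ _).const_mul _)
  · exact ((hi _ _).const_mul _).sub ((hi _ _).const_mul _)
  simp only [integral_const_mul] at h0
  change J α (derivX k φ) θ q + (q.1 k : ℂ) * J α φ (derivT θ) q +
        (Complex.I * (Real.cot (α k) : ℝ) * J α (mulX k φ) θ q -
        Complex.I * ((q.2.2 k * (Real.sin (α k))⁻¹ : ℝ) : ℂ) * J α φ θ q) = 0 at h0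
  have hs : (Real.sin (α k) : ℂ) * ((Real.sin (α k))⁻¹ : ℝ) = 1 := by
    rw [← Complex.ofReal_mul, mul_inv_cancel₀ (hα k), Complex.ofReal_one]
  push_cast [-Complex.ofReal_sin, -Complex.ofReal_cot, -Complex.ofReal_inv] at h0 ⊢
  have hI := Complex.I_mul_I
  -- Multiplying by `i sin α_k` isolates `a_k J`; `hs` cancels the sine and `hI` replaces `i²`.
  linear_combination (-(Real.sin (α k) : ℂ) * (-Complex.I)) * h0 -
    (q.2.2 k : ℂ) * J α φ θ q * hs + (- (Real.sin (α k) : ℂ) * Real.cot (α k) * J α (mulX k φ) θ q +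
      (Real.sin (α k) : ℂ) * ((Real.sin (α k))⁻¹ : ℝ) * (q.2.2 k : ℂ) * J α φ θ q) * hI

/-- Multiplication of the transform by `b`. -/
lemma mulB_J {d : ℕ} (α : Fin (d + 1) → ℝ) (φ : 𝓢(E d, ℂ)) (θ : 𝓢(ℝ, ℂ)) (q : Q d) :
    (q.2.1 : ℂ) * J α φ θ q = ∑ k, (q.1 k : ℂ) * J α (mulX k φ) θ q - J α φ (mulT θ) q := by
  have hi := fun φ θ => integrable_integrandJ α φ θ q
  unfold J
  simp_rw [← integral_const_mul]
  rw [← integral_finsetSum _ fun k _ => (hi _ _).const_mul _,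
    ← integral_sub (integrable_finsetSum _ fun k _ => (hi _ _).const_mul _) (hi _ _)]
  congr 1
  funext x
  -- Pointwise this is `b = v·x - (v·x - b)`, the bracket being the argument of the window.
  simp only [integrandJ, mulX_apply, mulT_apply, inner_eq_sum]
  push_cast
  have : ∑ k, (q.1 k : ℂ) * ((x k : ℂ) * φ x * θ (∑ k, q.1 k * x k - q.2.1) * kernel α x q.2.2) =
      (∑ k, (q.1 k : ℂ) * (x k : ℂ)) * (φ x * θ (∑ k, q.1 k * x k - q.2.1) * kernel α x q.2.2) := by
    rw [Finset.sum_mul]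
    exact Finset.sum_congr rfl fun k _ => by ring
  rw [this]
  ring

/-! ### Uniform bounds by continuous seminorms -/

/-- The family of functions `B i` is bounded by one continuous seminorm. -/
def SeminormBdd {X ι : Type*} [AddCommGroup X] [Module ℂ X] [TopologicalSpace X]
    (B : X → ι → ℝ) : Prop :=
  ∃ p : Seminorm ℂ X, Continuous p ∧ ∀ x i, B x i ≤ p x

section SeminormBdd

variable {X ι : Type*} [AddCommGroup X] [Module ℂ X] [TopologicalSpace X]

lemma SeminormBdd.mono {B B' : X → ι → ℝ} (h : SeminormBdd B) (hB : ∀ x i, B' x i ≤ B x i) :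
    SeminormBdd B' := by
  obtain ⟨p, hp, h⟩ := h
  exact ⟨p, hp, fun x i => (hB x i).trans (h x i)⟩

lemma SeminormBdd.add {B B' : X → ι → ℝ} (h : SeminormBdd B) (h' : SeminormBdd B') :
    SeminormBdd (fun x i => B x i + B' x i) := by
  obtain ⟨p, hp, h⟩ := h
  obtain ⟨p', hp', h'⟩ := h'
  exact ⟨p + p', hp.add hp', fun x i => add_le_add (h x i) (h' x i)⟩

lemma SeminormBdd.const_mul {B : X → ι → ℝ} (h : SeminormBdd B) {C : ℝ} (hC : 0 ≤ C) :
    SeminormBdd (fun x i => C * B x i) := by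
  obtain ⟨p, hp, h⟩ := h
  lift C to NNReal using hC
  exact ⟨C • p, hp.const_smul C, fun x i => mul_le_mul_of_nonneg_left (h x i) C.2⟩

lemma SeminormBdd.zero : SeminormBdd (fun (_ : X) (_ : ι) => (0 : ℝ)) :=
  ⟨0, continuous_const, fun _ _ => le_rfl⟩

lemma SeminormBdd.sum {κ : Type*} {s : Finset κ} {B : κ → X → ι → ℝ}
    (h : ∀ k, SeminormBdd (B k)) : SeminormBdd (fun x i => ∑ k ∈ s, B k x i) := by
  classical
  induction s using Finset.induction_on with
  | empty => simpa using SeminormBdd.zero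
  | insert a s ha ih => simpa [Finset.sum_insert ha] using (h a).add ih

end SeminormBdd

/-- The `L¹` norm is controlled by the Schwartz seminorms with weights `0` and `N`, where `(1 +
‖x‖)^(-N)` is integrable. -/
lemma seminormBdd_integral_norm (d : ℕ) :
    SeminormBdd (fun (φ : 𝓢(E d, ℂ)) (_ : Unit) => ∫ x, ‖φ x‖) := by
  have h : ∀ k, SeminormBdd (fun (φ : 𝓢(E d, ℂ)) (_ : Unit) => SchwartzMap.seminorm ℂ k 0 φ) :=
    fun k => ⟨SchwartzMap.seminorm ℂ k 0,
      (schwartz_withSeminorms ℂ (E d) ℂ).continuous_seminorm (k, 0), fun _ _ => le_rfl⟩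
  refine (((h 0).add (h (0 + (volume : Measure (E d)).integrablePower))).const_mul
    (C := 2 ^ (volume : Measure (E d)).integrablePower *
      (∫ x : E d, (1 + ‖x‖) ^ (- ((volume : Measure (E d)).integrablePower : ℝ))))
    (by positivity)).mono fun φ _ => ?_
  simpa using SchwartzMap.integral_pow_mul_iteratedFDeriv_le ℂ volume φ 0 0

/-- The `L¹` bound is uniform in `q`; pulling it back along the continuous `T` leaves a continuous
seminorm of `φ`. -/
lemma seminormBdd_norm_J {d : ℕ} (α : Fin (d + 1) → ℝ) (T : 𝓢(E d, ℂ) →L[ℂ] 𝓢(E d, ℂ))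
    (θ : 𝓢(ℝ, ℂ)) : SeminormBdd (fun φ (q : Q d) => ‖J α (T φ) θ q‖) := by
  obtain ⟨C, hC, h⟩ := exists_norm_integrandJ_le (d := d) α θ
  obtain ⟨p, hp, hpb⟩ := (seminormBdd_integral_norm d).const_mul hC
  refine ⟨p.comp (T : 𝓢(E d, ℂ) →ₗ[ℂ] 𝓢(E d, ℂ)), hp.comp T.continuous, fun φ q => ?_⟩
  refine le_trans ?_ (hpb (T φ) ())
  beta_reduce
  rw [← integral_const_mul]
  exact norm_integral_le_of_norm_le ((T φ).integrable.norm.const_mul C)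
    (.of_forall fun x => h (T φ) q x)

/-! ### The algebra of functions generated by the transform -/

/-- The radial projection with values in the ambient space. -/
def rad {d : ℕ} (x : E d) : E d := radialProj x

lemma rad_ne_zero {d : ℕ} (x : E d) : rad x ≠ 0 := coe_ne_zero _

lemma rad_coe {d : ℕ} (u : Sph d) : rad (u : E d) = u := by rw [rad, radialProj_coe]

lemma rad_rad {d : ℕ} (x : E d) : rad (rad x) = rad x := rad_coe _

lemma contDiffAt_rad {d : ℕ} {x : E d} (hx : x ≠ 0) : ContDiffAt ℝ ∞ (rad (d := d)) x := by
  refine (((contDiffAt_norm ℝ hx).inv (norm_ne_zero_iff.2 hx)).smul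
    contDiffAt_id).congr_of_eventuallyEq ?_
  filter_upwards [isOpen_ne.mem_nhds hx] with z hz
  simp [rad, radialProj, show z ≠ 0 from hz]

/-- The radial projection in the first variable. -/
def radQ {d : ℕ} (q : Q d) : Q d := (rad q.1, q.2)

lemma radQ_radQ {d : ℕ} (q : Q d) : radQ (radQ q) = radQ q := by simp [radQ, rad_rad]

lemma contDiffAt_radQ {d : ℕ} {q : Q d} (hq : q.1 ≠ 0) : ContDiffAt ℝ ∞ (radQ (d := d)) q :=
  ((contDiffAt_rad hq).comp q contDiffAt_fst).prodMk contDiffAt_snd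

/-- Smoothness away from the origin. -/
def SmoothOff {d : ℕ} (c : E d → ℂ) : Prop := ∀ x, x ≠ 0 → ContDiffAt ℝ ∞ c x

lemma SmoothOff.const {d : ℕ} (c : ℂ) : SmoothOff (fun _ : E d => c) :=
  fun _ _ => contDiffAt_const

lemma SmoothOff.mul {d : ℕ} {c c' : E d → ℂ} (h : SmoothOff c) (h' : SmoothOff c') :
    SmoothOff (fun x => c x * c' x) := fun x hx => (h x hx).mul (h' x hx)

lemma SmoothOff.comp_rad {d : ℕ} {c : E d → ℂ} (h : SmoothOff c) :
    SmoothOff (fun x => c (rad x)) :=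
  fun x hx => (h _ (rad_ne_zero x)).comp x (contDiffAt_rad hx)

lemma SmoothOff.fderiv {d : ℕ} {c : E d → ℂ} (h : SmoothOff c) (v : E d) :
    SmoothOff (fun x => fderiv ℝ c x v) :=
  fun x hx => ((h x hx).fderiv_right (m := ∞) (by simp)).clm_apply contDiffAt_const

lemma smoothOff_rad {d : ℕ} (k : Fin (d + 1)) : SmoothOff (fun x : E d => (rad x k : ℂ)) :=
  fun x hx => (coordC k).contDiff.contDiffAt.comp x (contDiffAt_rad hx)

lemma smoothOff_fderiv_rad {d : ℕ} (k : Fin (d + 1)) (v : E d) :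
    SmoothOff (fun x : E d => ((fderiv ℝ rad x v) k : ℂ)) :=
  fun x hx => (coordC k).contDiff.contDiffAt.comp x
    (((contDiffAt_rad hx).fderiv_right (m := ∞) (by simp)).clm_apply contDiffAt_const)

/-- The functions of `(v, b, a)` depending linearly on `φ` that are generated by the transform,
with coefficients depending on `v`, and constant along rays in `v` up to these coefficients. -/
inductive Generated {d : ℕ} (α : Fin (d + 1) → ℝ) : (𝓢(E d, ℂ) → Q d → ℂ) → Prop
  | zero : Generated α (fun _ _ => 0)
  | base (c : E d → ℂ) (hc : SmoothOff c) (T : 𝓢(E d, ℂ) →L[ℂ] 𝓢(E d, ℂ)) (θ : 𝓢(ℝ, ℂ)) :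
      Generated α (fun φ q => c q.1 * J α (T φ) θ (radQ q))
  | add (L L') : Generated α L → Generated α L' → Generated α (fun φ q => L φ q + L' φ q)

namespace Generated

variable {d : ℕ} {α : Fin (d + 1) → ℝ} {L L' : 𝓢(E d, ℂ) → Q d → ℂ}

lemma congr (h : Generated α L) (h' : ∀ φ q, L' φ q = L φ q) : Generated α L' := by
  have : L' = L := funext fun φ => funext fun q => h' φ q
  exact this ▸ h

lemma sum {κ : Type*} {s : Finset κ} {L : κ → 𝓢(E d, ℂ) → Q d → ℂ}
    (h : ∀ k, Generated α (L k)) : Generated α (fun φ q => ∑ k ∈ s, L k φ q) := by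
  classical
  induction s using Finset.induction_on with
  | empty => simpa using Generated.zero
  | insert a s ha ih => simpa [Finset.sum_insert ha] using (h a).add _ _ ih

lemma mul_left (h : Generated α L) {c : E d → ℂ} (hc : SmoothOff c) :
    Generated α (fun φ q => c q.1 * L φ q) := by
  induction h with
  | zero => simpa using Generated.zero
  | base c' hc' T θ => exact (base _ (hc.mul hc') T θ).congr fun φ q => by ring
  | add L L' _ _ ih ih' => exact (ih.add _ _ ih').congr fun φ q => by ring

lemma const_mul (h : Generated α L) (c : ℂ) : Generated α (fun φ q => c * L φ q) :=
  h.mul_left (SmoothOff.const c)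

/-- `mulA_J` trades `a_k` for operations on `φ` and the window and a coefficient `u_k`. Polynomial
growth in `a` therefore never leaves the class, whose members are bounded. -/
lemma mulA (hα : ∀ k, Real.sin (α k) ≠ 0) (h : Generated α L) (k : Fin (d + 1)) :
    Generated α (fun φ q => (q.2.2 k : ℂ) * L φ q) := by
  induction h with
  | zero => simpa using Generated.zero
  | base c hc T θ =>
    refine ((((base c hc ((derivX k).comp T) θ).add _ _
      ((base c hc T (derivT θ)).mul_left (smoothOff_rad k))).const_mul
        (-Complex.I * (Real.sin (α k) : ℂ))).add _ _
      ((base c hc ((mulX k).comp T) θ).const_mul (Real.sin (α k) * Real.cot (α k) : ℝ))).congr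
      fun φ q => ?_
    have := mulA_J hα k (T φ) θ (radQ q)
    simp only [radQ, ContinuousLinearMap.comp_apply] at this ⊢
    linear_combination c q.1 * this
  | add L L' _ _ ih ih' => exact (ih.add _ _ ih').congr fun φ q => by ring

lemma mulB (h : Generated α L) : Generated α (fun φ q => (q.2.1 : ℂ) * L φ q) := by
  induction h with
  | zero => simpa using Generated.zero
  | base c hc T θ =>
    refine ((sum (s := Finset.univ) fun k => (base c hc ((mulX k).comp T) θ).mul_left
      (smoothOff_rad k)).add _ _ ((base c hc T (mulT θ)).const_mul (-1))).congr fun φ q => ?_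
    have := mulB_J α (T φ) θ (radQ q)
    simp only [radQ, ContinuousLinearMap.comp_apply] at this ⊢
    rw [mul_left_comm, this, mul_sub, Finset.mul_sum]
    rw [sub_eq_add_neg]
    congr 1
    · exact Finset.sum_congr rfl fun k _ => by ring
    · ring
  | add L L' _ _ ih ih' => exact (ih.add _ _ ih').congr fun φ q => by ring

/-- Restricting to the sphere and extending along rays is composition with `radQ`, which is
idempotent, so only the coefficients change. -/
lemma comp_radQ (h : Generated α L) : Generated α (fun φ q => L φ (radQ q)) := by
  induction h with
  | zero => exact Generated.zero
  | base c hc T θ =>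
    refine (base _ hc.comp_rad T θ).congr fun φ q => ?_
    simp only [radQ_radQ]
    rfl
  | add L L' _ _ ih ih' => exact ih.add _ _ ih'

lemma contDiffAt (h : Generated α L) (φ : 𝓢(E d, ℂ)) {q : Q d} (hq : q.1 ≠ 0) :
    ContDiffAt ℝ ∞ (L φ) q := by
  induction h with
  | zero => exact contDiffAt_const
  | base c hc T θ =>
    exact ((hc _ hq).comp q contDiffAt_fst).mul
      ((contDiff_J α (T φ) θ).contDiffAt.comp q (contDiffAt_radQ hq))
  | add L L' _ _ ih ih' => exact ih.add ih'

/-- Chain rule through `c`, the radial projection and `derivJ`. The formula is claimed only away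
from the origin, where coefficients and projection are smooth. -/
lemma exists_fderiv (h : Generated α L) (hα : ∀ k, Real.sin (α k) ≠ 0) (w : Q d) :
    ∃ L', Generated α L' ∧ ∀ φ q, q.1 ≠ 0 → fderiv ℝ (L φ) q w = L' φ q := by
  induction h with
  | zero => exact ⟨_, Generated.zero, fun φ q _ => by simp⟩
  | base c hc T θ =>
    -- The terms come from the coefficient, then from the directions `v`, `b` and `a`; the factor
    -- `a_k` in the last is removed by `mulA`.
    refine ⟨_, (base _ (hc.fderiv w.1) T θ).add _ _ ((((sum (s := Finset.univ) fun k =>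
      (base c hc ((mulX k).comp T) (derivT θ)).mul_left (smoothOff_fderiv_rad k w.1)).add _ _
      ((base c hc T (derivT θ)).const_mul (-w.2.1))).add _ _ (sum (s := Finset.univ) fun k =>
      (((base c hc T θ).mulA hα k).const_mul (w.2.2 k * (Complex.I * Real.cot (α k)))).add _ _
      ((base c hc ((mulX k).comp T) θ).const_mul
        (w.2.2 k * -(Complex.I * ((Real.sin (α k))⁻¹ : ℝ))))))), fun φ q hq => ?_⟩
    have h1 : HasFDerivAt (fun q : Q d => c q.1) _ q :=
      HasFDerivAt.comp q ((hc _ hq).differentiableAt (by simp)).hasFDerivAt hasFDerivAt_fst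
    have h2 : HasFDerivAt (radQ (d := d)) _ q :=
      (HasFDerivAt.comp q ((contDiffAt_rad hq).differentiableAt (by simp)).hasFDerivAt
        hasFDerivAt_fst).prodMk hasFDerivAt_snd
    have h3 : HasFDerivAt (fun q : Q d => J α (T φ) θ (radQ q)) _ q :=
      HasFDerivAt.comp (g := J α (T φ) θ) q (hasFDerivAt_J α (T φ) θ (radQ q)) h2
    change (fderiv ℝ ((fun q : Q d => c q.1) * fun q : Q d => J α (T φ) θ (radQ q)) q) w = _
    rw [(h1.mul h3).fderiv]
    simp only [derivJ, add_apply, smul_apply, ContinuousLinearMap.comp_apply, smul_eq_mul,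
      sub_apply, sum_apply, ContinuousLinearMap.prod_apply, covV_apply, covB_apply, covA_apply,
      ContinuousLinearMap.coe_fst', ContinuousLinearMap.coe_snd', radQ]
    rw [add_comm, mul_add, mul_sub, Finset.mul_sum, Finset.mul_sum, sub_eq_add_neg]
    refine congrArg₂ _ (by ring) (congrArg₂ _ (congrArg₂ _
      (Finset.sum_congr rfl fun k _ => by ring) (by ring))
      (Finset.sum_congr rfl fun k _ => by push_cast; ring))
  | add L L' h h' ih ih' =>
    obtain ⟨M, hM, e⟩ := ih
    obtain ⟨M', hM', e'⟩ := ih'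
    refine ⟨_, hM.add _ _ hM', fun φ q hq => ?_⟩
    rw [fderiv_fun_add ((h.contDiffAt φ hq).differentiableAt (by simp))
      ((h'.contDiffAt φ hq).differentiableAt (by simp)), add_apply, e φ q hq, e' φ q hq]

/-- The coefficients are continuous on the compact sphere, hence bounded there. -/
lemma seminormBdd (h : Generated α L) :
    SeminormBdd (fun φ (y : Y d) => ‖L φ ((y.1 : E d), y.2)‖) := by
  induction h with
  | zero => simpa using SeminormBdd.zero
  | base c hc T θ =>
    have hcont : Continuous (fun u : Sph d => c u) :=
      continuous_iff_continuousAt.2 fun u =>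
        ContinuousAt.comp (f := fun u : Sph d => (u : E d)) (hc _ (coe_ne_zero u)).continuousAt
          continuous_subtype_val.continuousAt
    obtain ⟨C, hC⟩ := (isCompact_range hcont).isBounded.exists_norm_le
    obtain ⟨p, hp, hb⟩ := (seminormBdd_norm_J α T θ).const_mul (le_max_right C 0)
    refine ⟨p, hp, fun φ y => le_trans ?_ (hb φ (radQ ((y.1 : E d), y.2)))⟩
    beta_reduce
    rw [norm_mul]
    gcongr
    exact (hC _ ⟨y.1, rfl⟩).trans (le_max_left C 0)
  | add L L' _ _ ih ih' => exact (ih.add ih').mono fun φ y => norm_add_le _ _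

end Generated

/-! ### Differential operators on `𝕐²ⁿ` as derivatives of the radial extension -/

lemma partialB_eq_fderiv_extY {d : ℕ} {Φ : Y d → ℂ} (h : IsSmoothY Φ) (y : Y d) :
    partialB Φ y = fderiv ℝ (extY Φ) ((y.1 : E d), y.2) (0, 1, 0) := by
  have h1 := ((h.contDiffAt_extY (q := ((y.1 : E d), y.2)) (coe_ne_zero y.1)).differentiableAt
    (by simp)).hasFDerivAt
  have h2 : HasDerivAt (fun b : ℝ => (((y.1 : E d), b, y.2.2) : E d × ℝ × E d)) (0, 1, 0) y.2.1 :=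
    (hasDerivAt_const _ _).prodMk ((hasDerivAt_id _).prodMk (hasDerivAt_const _ _))
  have h3 := HasFDerivAt.comp_hasDerivAt (f := fun b : ℝ =>
    (((y.1 : E d), b, y.2.2) : E d × ℝ × E d)) y.2.1 h1 h2
  have h4 : (extY Φ ∘ fun b : ℝ => (((y.1 : E d), b, y.2.2) : E d × ℝ × E d)) =
      fun b : ℝ => Φ (y.1, b, y.2.2) := by
    funext b; simp [extY, radialProj_coe]
  rw [h4] at h3
  exact h3.deriv

lemma contDiff_sliceA {d : ℕ} {Φ : Y d → ℂ} (h : IsSmoothY Φ) (u : Sph d) (b : ℝ) :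
    ContDiff ℝ ∞ (fun a : E d => Φ (u, b, a)) := by
  have h4 : (fun a : E d => Φ (u, b, a)) = fun a : E d => extY Φ ((u : E d), b, a) := by
    funext b; simp [extY, radialProj_coe]
  rw [h4, contDiff_iff_contDiffAt]
  intro a
  exact ContDiffAt.comp (f := fun a : E d => (((u : E d), b, a) : E d × ℝ × E d)) (g := extY Φ) a
    (h.contDiffAt_extY (coe_ne_zero u)) (by fun_prop)

lemma partialA_eq_fderiv {d : ℕ} {Φ : Y d → ℂ} (h : IsSmoothY Φ) (k : Fin (d + 1)) (y : Y d) :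
    partialA k Φ y = fderiv ℝ (fun a : E d => Φ (y.1, y.2.1, a)) y.2.2
      (EuclideanSpace.single k 1) :=
  ((contDiff_sliceA h y.1 y.2.1).contDiffAt.differentiableAt (by simp)).lineDeriv_eq_fderiv

lemma partialA_eq_fderiv_extY {d : ℕ} {Φ : Y d → ℂ} (h : IsSmoothY Φ) (k : Fin (d + 1)) (y : Y d) :
    partialA k Φ y = fderiv ℝ (extY Φ) ((y.1 : E d), y.2) (0, 0, EuclideanSpace.single k 1) := by
  have h1 := ((h.contDiffAt_extY (q := ((y.1 : E d), y.2)) (coe_ne_zero y.1)).differentiableAt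
    (by simp)).hasFDerivAt
  have h2 : HasFDerivAt (fun a : E d => (((y.1 : E d), y.2.1, a) : E d × ℝ × E d))
      ((0 : E d →L[ℝ] E d).prod ((0 : E d →L[ℝ] ℝ).prod (ContinuousLinearMap.id ℝ (E d)))) y.2.2 :=
    (hasFDerivAt_const _ _).prodMk ((hasFDerivAt_const _ _).prodMk (hasFDerivAt_id _))
  have h3 := HasFDerivAt.comp (f := fun a : E d =>
    (((y.1 : E d), y.2.1, a) : E d × ℝ × E d)) y.2.2 h1 h2
  have h4 : (extY Φ ∘ fun a : E d => (((y.1 : E d), y.2.1, a) : E d × ℝ × E d)) =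
      fun a : E d => Φ (y.1, y.2.1, a) := by
    funext b; simp [extY, radialProj_coe]
  rw [h4] at h3
  rw [partialA_eq_fderiv h, h3.fderiv]
  simp

/-- The functions on `𝕐²ⁿ` generated by the transform. -/
def GeneratedY {d : ℕ} (α : Fin (d + 1) → ℝ) (M : 𝓢(E d, ℂ) → Y d → ℂ) : Prop :=
  ∃ L, Generated α L ∧ ∀ φ y, M φ y = L φ ((y.1 : E d), y.2)

namespace GeneratedY

variable {d : ℕ} {α : Fin (d + 1) → ℝ} {M M' : 𝓢(E d, ℂ) → Y d → ℂ}

lemma extY (h : GeneratedY α M) : Generated α (fun φ => extY (M φ)) := by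
  obtain ⟨L, hL, e⟩ := h
  exact hL.comp_radQ.congr fun φ q => e φ _

lemma isSmoothY (h : GeneratedY α M) (φ : 𝓢(E d, ℂ)) : IsSmoothY (M φ) := by
  obtain ⟨L, hL, e⟩ := h
  exact isSmoothY_of_contDiffAt (fun q hq => hL.contDiffAt φ hq) (e φ)

lemma seminormBdd (h : GeneratedY α M) : SeminormBdd (fun φ y => ‖M φ y‖) := by
  obtain ⟨L, hL, e⟩ := h
  simpa only [e] using hL.seminormBdd

lemma add (h : GeneratedY α M) (h' : GeneratedY α M') :
    GeneratedY α (fun φ y => M φ y + M' φ y) := by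
  obtain ⟨L, hL, e⟩ := h
  obtain ⟨L', hL', e'⟩ := h'
  exact ⟨_, hL.add _ _ hL', fun φ y => by beta_reduce; rw [e, e']⟩

lemma mulA (h : GeneratedY α M) (hα : ∀ k, Real.sin (α k) ≠ 0) (k : Fin (d + 1)) :
    GeneratedY α (fun φ y => (y.2.2 k : ℂ) * M φ y) := by
  obtain ⟨L, hL, e⟩ := h
  exact ⟨_, hL.mulA hα k, fun φ y => by beta_reduce; rw [e]⟩

lemma mulB (h : GeneratedY α M) : GeneratedY α (fun φ y => (y.2.1 : ℂ) * M φ y) := by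
  obtain ⟨L, hL, e⟩ := h
  exact ⟨_, hL.mulB, fun φ y => by beta_reduce; rw [e]⟩

lemma sum {κ : Type*} {s : Finset κ} {M : κ → 𝓢(E d, ℂ) → Y d → ℂ}
    (h : ∀ k, GeneratedY α (M k)) : GeneratedY α (fun φ y => ∑ k ∈ s, M k φ y) := by
  choose L hL e using h
  exact ⟨_, Generated.sum (s := s) hL, fun φ y => Finset.sum_congr rfl fun k _ => e k φ y⟩

lemma partialB (h : GeneratedY α M) (hα : ∀ k, Real.sin (α k) ≠ 0) :
    GeneratedY α (fun φ => partialB (M φ)) := by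
  obtain ⟨L, hL, e⟩ := h.extY.exists_fderiv hα (0, 1, 0)
  exact ⟨L, hL, fun φ y => by
    beta_reduce
    rw [partialB_eq_fderiv_extY (h.isSmoothY φ), e _ _ (coe_ne_zero y.1)]⟩

lemma partialA (h : GeneratedY α M) (hα : ∀ k, Real.sin (α k) ≠ 0) (k : Fin (d + 1)) :
    GeneratedY α (fun φ => partialA k (M φ)) := by
  obtain ⟨L, hL, e⟩ := h.extY.exists_fderiv hα (0, 0, EuclideanSpace.single k 1)
  exact ⟨L, hL, fun φ y => by
    beta_reduce
    rw [partialA_eq_fderiv_extY (h.isSmoothY φ), e _ _ (coe_ne_zero y.1)]⟩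

/-- The Laplacian of the radial extension is a sum of pure second derivatives, so
`Generated.exists_fderiv` is applied twice. -/
lemma laplaceU (h : GeneratedY α M) (hα : ∀ k, Real.sin (α k) ≠ 0) :
    GeneratedY α (fun φ => laplaceU (M φ)) := by
  choose L hL e using fun i : Fin (d + 1) =>
    h.extY.exists_fderiv hα (EuclideanSpace.single i 1, 0)
  choose L' hL' e' using fun i : Fin (d + 1) =>
    (hL i).exists_fderiv hα (EuclideanSpace.single i 1, 0)
  refine ⟨_, Generated.sum (s := Finset.univ) hL', fun φ y => ?_⟩
  refine (laplacian_slice (h.isSmoothY φ) y.2 (coe_ne_zero y.1)).trans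
    (Finset.sum_congr rfl fun i _ => ?_)
  rw [← e' i φ _ (coe_ne_zero y.1)]
  congr 1
  -- The first derivative is known only off the origin, but a neighbourhood of a point of the sphere
  -- suffices.
  refine Filter.EventuallyEq.fderiv_eq ?_
  have : ∀ᶠ q : Q d in nhds ((y.1 : E d), y.2), q.1 ≠ 0 :=
    continuous_fst.continuousAt.eventually_ne (coe_ne_zero y.1)
  filter_upwards [this] with q hq
  exact e i φ q hq

lemma iterate {D : (Y d → ℂ) → (Y d → ℂ)}
    (hD : ∀ M, GeneratedY α M → GeneratedY α (fun φ => D (M φ))) (h : GeneratedY α M) (n : ℕ) :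
    GeneratedY α (fun φ => D^[n] (M φ)) := by
  induction n with
  | zero => exact h
  | succ n ih => simpa only [Function.iterate_succ_apply'] using hD _ ih

lemma derivY (h : GeneratedY α M) (hα : ∀ k, Real.sin (α k) ≠ 0) (l : Fin (d + 1) → ℕ)
    (m k : ℕ) : GeneratedY α (fun φ => derivY l m k (M φ)) := by
  have h1 := iterate (fun M hM => hM.partialB hα) (iterate (fun M hM => hM.laplaceU hα) h k) m
  unfold DSTFRFT.derivY multiPartialA
  induction List.finRange (d + 1) with
  | nil => exact h1
  | cons j s ih => exact iterate (fun M hM => hM.partialA hα j) ih (l j)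

/-- Integer powers of `1 + b²` and `1 + ∑ a_k²` are polynomials, hence obtained from `mulA` and
`mulB`. -/
lemma weight (h : GeneratedY α M) (hα : ∀ k, Real.sin (α k) ≠ 0) (s r : ℕ) :
    GeneratedY α (fun φ y => ((1 + y.2.1 ^ 2 : ℝ) : ℂ) ^ r *
      (((1 + ‖y.2.2‖ ^ 2 : ℝ) : ℂ) ^ s * M φ y)) := by
  have hs : GeneratedY α (fun φ y => ((1 + ‖y.2.2‖ ^ 2 : ℝ) : ℂ) ^ s * M φ y) := by
    induction s with
    | zero => simpa using h
    | succ s ih =>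
      have h1 := ih.add (sum (s := Finset.univ) fun k => (ih.mulA hα k).mulA hα k)
      convert! h1 using 1
      funext φ y
      rw [EuclideanSpace.real_norm_sq_eq]
      push_cast
      simp_rw [← mul_assoc]
      rw [← Finset.sum_mul, ← Finset.sum_mul]
      simp_rw [← sq]
      ring
  induction r with
  | zero => simpa using hs
  | succ r ih =>
    convert! ih.add ih.mulB.mulB using 1
    funext φ y
    push_cast
    ring

/-- The half-integral powers of the seminorms are dominated by integral ones, the bases being at
least `1`. -/
lemma seminormBdd_weightedY (h : GeneratedY α M) (hα : ∀ k, Real.sin (α k) ≠ 0) (s r : ℕ)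
    (l : Fin (d + 1) → ℕ) (m k : ℕ) :
    SeminormBdd (fun φ y => weightedY s r l m k (M φ) y) := by
  refine ((h.derivY hα l m k).weight hα s r).seminormBdd.mono fun φ y => ?_
  have hle : ∀ (t : ℝ) (n : ℕ), 0 ≤ t → (1 + t) ^ ((n : ℝ) / 2) ≤ (1 + t) ^ n := fun t n ht => by
    rw [← Real.rpow_natCast]
    exact Real.rpow_le_rpow_of_exponent_le (by linarith) (half_le_self (Nat.cast_nonneg n))
  rw [weightedY, sq_abs, norm_mul, norm_mul, norm_pow, norm_pow, Complex.norm_real,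
    Complex.norm_real, Real.norm_of_nonneg (by positivity), Real.norm_of_nonneg (by positivity),
    mul_assoc]
  gcongr
  · exact hle _ _ (by positivity)
  · exact hle _ _ (by positivity)

end GeneratedY

/-! ### The analysis operator on test functions -/

lemma J_add {d : ℕ} (α : Fin (d + 1) → ℝ) (φ φ' : 𝓢(E d, ℂ)) (θ : 𝓢(ℝ, ℂ)) (q : Q d) :
    J α (φ + φ') θ q = J α φ θ q + J α φ' θ q := by
  rw [J, J, J, ← integral_add (integrable_integrandJ _ _ _ _) (integrable_integrandJ _ _ _ _)]
  congr 1
  funext x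
  simp [integrandJ]
  ring

lemma J_smul {d : ℕ} (α : Fin (d + 1) → ℝ) (c : ℂ) (φ : 𝓢(E d, ℂ)) (θ : 𝓢(ℝ, ℂ)) (q : Q d) :
    J α (c • φ) θ q = c * J α φ θ q := by
  rw [J, J, ← integral_const_mul]
  congr 1
  funext x
  simp [integrandJ]
  ring

lemma generatedY_J {d : ℕ} (α : Fin (d + 1) → ℝ) (θ : 𝓢(ℝ, ℂ)) :
    GeneratedY α (fun φ y => J α φ θ ((y.1 : E d), y.2)) :=
  ⟨_, Generated.base (fun _ => 1) (SmoothOff.const 1) (ContinuousLinearMap.id ℂ _) θ,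
    fun φ y => by simp [radQ, rad_coe]⟩

lemma isTopologicalAddGroup_schwartzY (d : ℕ) : IsTopologicalAddGroup (SchwartzY d) :=
  (withSeminormsY d).topologicalAddGroup

/-- The transform as a continuous linear map `𝒮(ℝⁿ) → 𝒮(𝕐²ⁿ)`. -/
lemma exists_analysisCLM {d : ℕ} {α : Fin (d + 1) → ℝ} (hα : ∀ k, Real.sin (α k) ≠ 0)
    (θ : 𝓢(ℝ, ℂ)) : ∃ A : 𝓢(E d, ℂ) →L[ℂ] SchwartzY d,
      ∀ φ y, A φ y = J α φ θ ((y.1 : E d), y.2) := by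
  have hG := generatedY_J α θ
  let A : 𝓢(E d, ℂ) →ₗ[ℂ] SchwartzY d :=
    { toFun := fun φ => ⟨fun y => J α φ θ ((y.1 : E d), y.2), hG.isSmoothY φ, fun s r l m k => by
        obtain ⟨p, -, hp⟩ := hG.seminormBdd_weightedY hα s r l m k
        exact ⟨p φ, by rintro _ ⟨y, rfl⟩; exact hp φ y⟩⟩
      map_add' := fun φ φ' => Subtype.ext (funext fun y => J_add α φ φ' θ _)
      map_smul' := fun c φ => Subtype.ext (funext fun y => J_smul α c φ θ _) }
  have := isTopologicalAddGroup_schwartzY d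
  refine ⟨⟨A, ?_⟩, fun φ y => rfl⟩
  -- The pointwise bound is uniform in `y`, so it passes to the supremum defining each seminorm.
  refine WithSeminorms.continuous_of_continuous_comp (withSeminormsY d) A fun i => ?_
  obtain ⟨p, hp, hb⟩ := hG.seminormBdd_weightedY hα i.1 i.2.1 i.2.2.1 i.2.2.2.1 i.2.2.2.2
  refine Seminorm.continuous_of_le hp fun φ => ?_
  have : Nonempty (Y d) := ⟨(radialProj 0, 0, 0)⟩
  exact ciSup_le fun y => hb φ y

/-- The outer conjugation undoes those on `φ` and on the window, and only changes `α` to `-α` in the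
kernel. -/
lemma conj_dstfrft {d : ℕ} (α : Fin (d + 1) → ℝ) (η : 𝓢(ℝ, ℂ)) (φ : 𝓢(E d, ℂ)) (y : Y d) :
    conj (dstfrft α η (fun x => conj (φ x)) y) = J (-α) φ η ((y.1 : E d), y.2) := by
  rw [dstfrft, ← integral_conj]
  congr 1
  funext x
  simp [integrandJ, conj_kernel]

/-! ### Partial derivatives in `a` -/

lemma isSmoothOp_multiPartialA {d : ℕ} (l : Fin (d + 1) → ℕ) :
    IsSmoothOp (multiPartialA (d := d) l) :=
  isSmoothOp_derivY l 0 0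

/-- Symmetry of the second derivative of the slice in `a`. -/
lemma partialA_comm {d : ℕ} {Φ : Y d → ℂ} (h : IsSmoothY Φ) (i j : Fin (d + 1)) :
    partialA i (partialA j Φ) = partialA j (partialA i Φ) := by
  funext y
  rw [partialA_eq_fderiv ((isSmoothOp_partialA j).smooth Φ h),
    partialA_eq_fderiv ((isSmoothOp_partialA i).smooth Φ h)]
  have hs := contDiff_sliceA h y.1 y.2.1
  have hd : DifferentiableAt ℝ (fderiv ℝ (fun a : E d => Φ (y.1, y.2.1, a))) y.2.2 :=
    (hs.contDiffAt.fderiv_right (m := ∞) (by simp)).differentiableAt (by simp)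
  have e : ∀ i j : Fin (d + 1), fderiv ℝ (fun a : E d => partialA j Φ (y.1, y.2.1, a)) y.2.2
      (EuclideanSpace.single i 1) = fderiv ℝ (fderiv ℝ (fun a : E d => Φ (y.1, y.2.1, a))) y.2.2
      (EuclideanSpace.single i 1) (EuclideanSpace.single j 1) := fun i j => by
    simp only [partialA_eq_fderiv h]
    rw [(hd.hasFDerivAt.clm_apply (hasFDerivAt_const (EuclideanSpace.single j 1) y.2.2)).fderiv]
    simp
  rw [e, e]
  exact (hs.contDiffAt (x := y.2.2)).isSymmSndFDerivAt
    (by simp only [minSmoothness_of_isRCLikeNormedField]; exact WithTop.coe_le_coe.2 le_top) _ _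

lemma partialA_iterate_comm {d : ℕ} {Φ : Y d → ℂ} (h : IsSmoothY Φ) (i j : Fin (d + 1)) (n : ℕ) :
    partialA i ((partialA j)^[n] Φ) = (partialA j)^[n] (partialA i Φ) := by
  induction n with
  | zero => rfl
  | succ n ih =>
    rw [Function.iterate_succ_apply', Function.iterate_succ_apply',
      partialA_comm (((isSmoothOp_partialA j).iterate n).smooth Φ h), ih]

/-- A multi-index derivative is composed in a fixed order, so the extra `∂_{a_k}` has to be commuted
to its place. -/
lemma partialA_multiPartialA {d : ℕ} {Φ : Y d → ℂ} (h : IsSmoothY Φ) (k : Fin (d + 1))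
    (l : Fin (d + 1) → ℕ) :
    partialA k (multiPartialA l Φ) = multiPartialA (l + Pi.single k 1) Φ := by
  obtain ⟨l', hl'⟩ : ∃ l' : Fin (d + 1) → ℕ, l' = l + Pi.single k 1 := ⟨_, rfl⟩
  have hk' : l' k = l k + 1 := by simp [hl']
  have hj' : ∀ j, j ≠ k → l' j = l j := fun j hj => by simp [hl', hj]
  rw [← hl']
  unfold multiPartialA
  -- Over a list without repetition the raised exponent acts once if `k` occurs and not at all
  -- otherwise. Smoothness of the partial compositions is carried along for the commutation.
  have key : ∀ s : List (Fin (d + 1)),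
      IsSmoothY (s.foldr (fun k Ψ => (partialA k)^[l k] Ψ) Φ) ∧
      (s.Nodup → (k ∉ s → s.foldr (fun j Ψ => (partialA j)^[l' j] Ψ) Φ =
          s.foldr (fun k Ψ => (partialA k)^[l k] Ψ) Φ) ∧
        (k ∈ s → s.foldr (fun j Ψ => (partialA j)^[l' j] Ψ) Φ =
          partialA k (s.foldr (fun k Ψ => (partialA k)^[l k] Ψ) Φ))) := by
    intro s
    induction s with
    | nil => exact ⟨h, fun _ => ⟨fun _ => rfl, fun hk => by simp at hk⟩⟩
    | cons j s ih =>
      obtain ⟨hs, ih⟩ := ih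
      refine ⟨((isSmoothOp_partialA j).iterate (l j)).smooth _ hs, fun hnd => ?_⟩
      obtain ⟨hj, hnd⟩ := List.nodup_cons.1 hnd
      obtain ⟨ih1, ih2⟩ := ih hnd
      constructor
      · intro hk
        simp only [List.mem_cons, not_or] at hk
        simp only [List.foldr_cons]
        rw [ih1 hk.2]
        rw [hj' j (Ne.symm hk.1)]
      · intro hk
        simp only [List.foldr_cons]
        by_cases hjk : k = j
        · subst hjk
          rw [ih1 hj]
          rw [hk', Function.iterate_succ_apply']
        · have hks : k ∈ s := by simpa [hjk] using hk
          rw [ih2 hks, partialA_iterate_comm hs, hj' j (Ne.symm hjk)]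
  exact (((key (List.finRange (d + 1))).2 (List.nodup_finRange _)).2 (List.mem_finRange k)).symm

lemma IsSmoothY.mulU {d : ℕ} {Φ : Y d → ℂ} (h : IsSmoothY Φ) (k : Fin (d + 1)) :
    IsSmoothY (fun y => ((y.1 : E d) k : ℂ) * Φ y) :=
  isSmoothY_of_contDiffAt (G := fun q => covV k q * extY Φ q)
    (fun _ hq => (covV k).contDiff.contDiffAt.mul (h.contDiffAt_extY hq))
    (fun y => by simp [extY, radialProj_coe])

lemma IsSmoothY.mulA {d : ℕ} {Φ : Y d → ℂ} (h : IsSmoothY Φ) (k : Fin (d + 1)) :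
    IsSmoothY (fun y => (y.2.2 k : ℂ) * Φ y) :=
  isSmoothY_of_contDiffAt (G := fun q => covA k q * extY Φ q)
    (fun _ hq => (covA k).contDiff.contDiffAt.mul (h.contDiffAt_extY hq))
    (fun y => by simp [extY, radialProj_coe])

lemma partialA_mulU {d : ℕ} {Φ : Y d → ℂ} (h : IsSmoothY Φ) (j k : Fin (d + 1)) :
    partialA j (fun y => ((y.1 : E d) k : ℂ) * Φ y) =
      fun y => ((y.1 : E d) k : ℂ) * partialA j Φ y := by
  funext y
  have hd := ((contDiff_sliceA h y.1 y.2.1).contDiffAt (x := y.2.2)).differentiableAt (by simp)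
  rw [partialA_eq_fderiv (h.mulU k), partialA_eq_fderiv h]
  have h1 := (hd.hasFDerivAt.const_mul ((y.1 : E d) k : ℂ)).fderiv
  have h2 : fderiv ℝ (fun a : E d => ((y.1 : E d) k : ℂ) * Φ (y.1, y.2.1, a)) y.2.2 = _ := h1
  rw [h2]
  simp

lemma partialA_mulA {d : ℕ} {Φ : Y d → ℂ} (h : IsSmoothY Φ) (j k : Fin (d + 1)) :
    partialA j (fun y => (y.2.2 k : ℂ) * Φ y) =
      fun y => (if k = j then 1 else 0) * Φ y + (y.2.2 k : ℂ) * partialA j Φ y := by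
  funext y
  have hd := ((contDiff_sliceA h y.1 y.2.1).contDiffAt (x := y.2.2)).differentiableAt (by simp)
  rw [partialA_eq_fderiv (h.mulA k), partialA_eq_fderiv h]
  have h1 := ((coordC k).hasFDerivAt (x := y.2.2)).mul hd.hasFDerivAt
  have h2 : fderiv ℝ (fun a : E d => (a k : ℂ) * Φ (y.1, y.2.1, a)) y.2.2 = _ := h1.fderiv
  rw [h2]
  by_cases hk : k = j
  · subst hk; simp; ring
  · simp [hk]

/-- The operators on `𝒮(𝕐²ⁿ)` generated by the derivatives in `a` and the multiplications by the
coordinates of `u` and `a`. -/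
inductive CoeffOp {d : ℕ} : (SchwartzY d → Y d → ℂ) → Prop
  | base (l) : CoeffOp (fun Φ => multiPartialA l Φ)
  | mulU (S) (k : Fin (d + 1)) : CoeffOp S → CoeffOp (fun Φ y => ((y.1 : E d) k : ℂ) * S Φ y)
  | mulA (S) (k : Fin (d + 1)) : CoeffOp S → CoeffOp (fun Φ y => (y.2.2 k : ℂ) * S Φ y)
  | add (S S') : CoeffOp S → CoeffOp S' → CoeffOp (fun Φ y => S Φ y + S' Φ y)
  | const_mul (S) (c : ℂ) : CoeffOp S → CoeffOp (fun Φ y => c * S Φ y)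

lemma norm_apply_sphere_le_one {d : ℕ} (u : Sph d) (k : Fin (d + 1)) : ‖((u : E d) k : ℂ)‖ ≤ 1 := by
  rw [Complex.norm_real]
  exact (PiLp.norm_apply_le (u : E d) k).trans (by simp)

namespace CoeffOp

variable {d : ℕ} {S : SchwartzY d → Y d → ℂ}

lemma id : CoeffOp (fun Φ : SchwartzY d => (Φ : Y d → ℂ)) := by
  have h := base (d := d) 0
  convert! h using 1
  funext Φ
  unfold multiPartialA
  induction List.finRange (d + 1) with
  | nil => rfl
  | cons j s ih => rw [List.foldr_cons, ← ih]; rfl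

lemma isSmoothY (h : CoeffOp S) (Φ : SchwartzY d) : IsSmoothY (S Φ) := by
  induction h with
  | base l => exact (isSmoothOp_multiPartialA l).smooth _ Φ.2.1
  | mulU S k _ ih => exact ih.mulU k
  | mulA S k _ ih => exact ih.mulA k
  | add S S' _ _ ih ih' => exact ih.add ih'
  | const_mul S c _ ih => exact ih.smul c

/-- Multiplication by `a_k` costs one more power of `1 + ‖a‖²`, which is why the induction is over
all `s`; multiplication by `u_k` costs nothing. -/
lemma seminormBdd (h : CoeffOp S) (r s : ℕ) : SeminormBdd (fun Φ (y : Y d) =>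
    (1 + y.2.1 ^ 2) ^ r * (1 + ‖y.2.2‖ ^ 2) ^ s * ‖S Φ y‖) := by
  induction h generalizing s with
  | base l =>
    -- The indices are doubled because the defining seminorms carry the exponents `s/2` and `r/2`.
    -- No derivative in `b` or `u` is needed.
    refine ⟨seminormFamilyY d (2 * s, 2 * r, l, 0, 0),
      (withSeminormsY d).continuous_seminorm _, fun Φ y => ?_⟩
    refine le_trans (le_of_eq ?_) (le_ciSup (Φ.2.2 (2 * s) (2 * r) l 0 0) y)
    have e : ∀ (t : ℝ) (n : ℕ), t ^ (((2 * n : ℕ) : ℝ) / 2) = t ^ n := fun t n => by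
      rw [← Real.rpow_natCast]; push_cast; congr 1; ring
    rw [weightedY, sq_abs, e, e]
    rfl
  | mulU S k _ ih =>
    refine (ih s).mono fun Φ y => ?_
    gcongr
    rw [norm_mul]
    exact mul_le_of_le_one_left (norm_nonneg _) (norm_apply_sphere_le_one _ _)
  | mulA S k _ ih =>
    refine (ih (s + 1)).mono fun Φ y => ?_
    have h1 : ‖(y.2.2 k : ℂ)‖ ≤ 1 + ‖y.2.2‖ ^ 2 := by
      rw [Complex.norm_real]
      have := PiLp.norm_apply_le y.2.2 k
      nlinarith [sq_nonneg (‖y.2.2‖ - 1)]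
    rw [norm_mul, pow_succ _ s, mul_assoc, mul_assoc, mul_assoc]
    gcongr
  | add S S' _ _ ih ih' =>
    refine ((ih s).add (ih' s)).mono fun Φ y => ?_
    rw [← mul_add]
    gcongr
    exact norm_add_le _ _
  | const_mul S c _ ih =>
    refine ((ih s).const_mul (norm_nonneg c)).mono fun Φ y => le_of_eq ?_
    rw [norm_mul]
    ring

/-- Leibniz rule: `∂_{a_j}` commutes with `u_k` and has commutator `δ_{jk}` with `a_k`. -/
lemma partialA (h : CoeffOp S) (j : Fin (d + 1)) : CoeffOp (fun Φ => partialA j (S Φ)) := by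
  induction h with
  | base l =>
    convert! base (d := d) (l + Pi.single j 1) using 1
    exact funext fun Φ => partialA_multiPartialA Φ.2.1 j l
  | mulU S k h ih =>
    convert! mulU _ k ih using 1
    exact funext fun Φ => partialA_mulU (h.isSmoothY Φ) j k
  | mulA S k h ih =>
    convert! (const_mul _ (if k = j then 1 else 0) h).add _ _ (mulA _ k ih) using 1
    exact funext fun Φ => partialA_mulA (h.isSmoothY Φ) j k
  | add S S' h h' ih ih' =>
    convert! add _ _ ih ih' using 1
    exact funext fun Φ => (isSmoothOp_partialA j).add _ _ (h.isSmoothY Φ) (h'.isSmoothY Φ)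
  | const_mul S c h ih =>
    convert! const_mul _ c ih using 1
    exact funext fun Φ => (isSmoothOp_partialA j).smul c _ (h.isSmoothY Φ)

end CoeffOp

/-! ### Integration over `𝕐²ⁿ` -/

lemma sphereMeasure_univ (d : ℕ) : sphereMeasure d Set.univ = 1 := by
  have h0 : (volume : Measure (E d)).toSphere Set.univ ≠ 0 := by
    rw [Measure.toSphere_apply_univ]
    refine mul_ne_zero (by simp) (Metric.measure_ball_pos volume _ one_pos).ne'
  rw [sphereMeasure, Measure.smul_apply, smul_eq_mul]
  exact ENNReal.inv_mul_cancel h0 (measure_ne_top _ _)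

instance isProbabilityMeasure_sphereMeasure (d : ℕ) : IsProbabilityMeasure (sphereMeasure d) :=
  ⟨sphereMeasure_univ d⟩

/-- The product measure on `𝕐²ⁿ`. -/
def measureY (d : ℕ) : Measure (Y d) := (sphereMeasure d).prod (volume.prod volume)

/-- An integrable weight in `(b, a)`. -/
def decay {d : ℕ} (p : ℝ × E d) : ℝ := ((1 + p.1 ^ 2) ^ 1)⁻¹ * ((1 + ‖p.2‖ ^ 2) ^ (d + 1))⁻¹

/-- The decay order `2(d + 1)` exceeds the dimension `d + 1`. -/
lemma integrable_decay_snd (d : ℕ) : Integrable (fun a : E d => ((1 + ‖a‖ ^ 2) ^ (d + 1))⁻¹) := by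
  have h := integrable_rpow_neg_one_add_norm_sq (E := E d) (μ := volume) (r := 2 * (d + 1 : ℕ))
    (by simp; linarith)
  convert! h using 1
  funext a
  rw [← Real.rpow_natCast, ← Real.rpow_neg (by positivity)]
  congr 1
  ring

lemma integrable_decay (d : ℕ) : Integrable (decay (d := d)) (volume.prod volume) := by
  have h := integrable_inv_one_add_sq.mul_prod (integrable_decay_snd d)
  convert! h using 1
  funext p
  simp [decay]

/-- Continuous functions on `𝕐²ⁿ` dominated by the weight. -/
structure Rapid {d : ℕ} (F : Y d → ℂ) : Prop where
  cont : Continuous F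
  bdd : ∃ C, ∀ y, ‖F y‖ ≤ C * decay y.2

namespace Rapid

variable {d : ℕ} {F F' : Y d → ℂ}

lemma mul (h : Rapid F) {m : Y d → ℂ} (hm : Continuous m) (hb : ∃ C, ∀ y, ‖m y‖ ≤ C) :
    Rapid (fun y => F y * m y) := by
  obtain ⟨C, hC⟩ := h.bdd
  obtain ⟨C', hC'⟩ := hb
  refine ⟨h.cont.mul hm, C * C', fun y => ?_⟩
  rw [norm_mul]
  calc ‖F y‖ * ‖m y‖ ≤ (C * decay y.2) * C' :=
        mul_le_mul (hC y) (hC' y) (norm_nonneg _) ((norm_nonneg _).trans (hC y))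
    _ = _ := by ring

lemma add (h : Rapid F) (h' : Rapid F') : Rapid (fun y => F y + F' y) := by
  obtain ⟨C, hC⟩ := h.bdd
  obtain ⟨C', hC'⟩ := h'.bdd
  refine ⟨h.cont.add h'.cont, C + C', fun y => (norm_add_le _ _).trans ?_⟩
  rw [add_mul]
  exact add_le_add (hC y) (hC' y)

lemma const_mul (h : Rapid F) (c : ℂ) : Rapid (fun y => c * F y) := by
  simpa only [mul_comm] using h.mul (m := fun _ => c) continuous_const ⟨‖c‖, fun _ => le_rfl⟩

lemma integrable_slice (h : Rapid F) (u : Sph d) :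
    Integrable (fun p => F (u, p)) (volume.prod volume) := by
  obtain ⟨C, hC⟩ := h.bdd
  exact ((integrable_decay d).const_mul C).mono'
    (h.cont.comp (by fun_prop : Continuous fun p => (u, p))).aestronglyMeasurable
    (.of_forall fun p => hC (u, p))

lemma integrable_sliceA (h : Rapid F) (u : Sph d) (b : ℝ) : Integrable (fun a => F (u, b, a)) := by
  obtain ⟨C, hC⟩ := h.bdd
  refine ((integrable_decay_snd d).const_mul (C * ((1 + b ^ 2) ^ 1)⁻¹)).mono'
    (h.cont.comp (by fun_prop : Continuous fun a => (u, b, a))).aestronglyMeasurable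
    (.of_forall fun a => (hC (u, b, a)).trans_eq ?_)
  simp only [decay]
  ring

lemma integrable (h : Rapid F) : Integrable F (measureY d) := by
  obtain ⟨C, hC⟩ := h.bdd
  have := (integrable_decay d).comp_snd (sphereMeasure d)
  exact (this.const_mul C).mono' h.cont.aestronglyMeasurable (.of_forall fun y => hC y)

lemma integral_eq (h : Rapid F) : ∫ y, F y ∂(measureY d) =
    ∫ u, ∫ b : ℝ, ∫ a : E d, F (u, b, a) ∂volume ∂volume ∂(sphereMeasure d) := by
  rw [measureY, integral_prod _ h.integrable]
  congr 1
  funext u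
  exact integral_prod (fun p => F (u, p)) (h.integrable_slice u)

lemma integral_eq_symm (h : Rapid F) : ∫ y, F y ∂(measureY d) =
    ∫ u, ∫ a : E d, ∫ b : ℝ, F (u, b, a) ∂volume ∂volume ∂(sphereMeasure d) := by
  rw [measureY, integral_prod _ h.integrable]
  congr 1
  funext u
  exact integral_prod_symm (fun p => F (u, p)) (h.integrable_slice u)

end Rapid

lemma norm_le_of_weight_le {d : ℕ} {F : Y d → ℂ} {C : ℝ}
    (h : ∀ y, (1 + y.2.1 ^ 2) ^ 1 * (1 + ‖y.2.2‖ ^ 2) ^ (d + 1) * ‖F y‖ ≤ C) (y : Y d) :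
    ‖F y‖ ≤ C * decay y.2 := by
  rw [decay, ← mul_inv, ← div_eq_mul_inv, le_div_iff₀ (by positivity), mul_comm]
  exact h y

lemma CoeffOp.rapid {d : ℕ} {S : SchwartzY d → Y d → ℂ} (h : CoeffOp S) (Φ : SchwartzY d) :
    Rapid (S Φ) := by
  obtain ⟨p, -, hp⟩ := h.seminormBdd 1 (d + 1)
  exact ⟨ContMDiff.continuous (h.isSmoothY Φ), p Φ, norm_le_of_weight_le (hp Φ)⟩

/-! ### The synthesis operator -/

/-- The integrand of the synthesis operator. -/
def integrandG {d : ℕ} (α : Fin (d + 1) → ℝ) (θ : 𝓢(ℝ, ℂ)) (F : Y d → ℂ) (x : E d) (y : Y d) : ℂ :=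
  F y * (θ (⟪(y.1 : E d), x⟫_ℝ - y.2.1) * kernel α x y.2.2)

/-- The synthesis operator with window `conj θ`, up to conjugations. -/
def G {d : ℕ} (α : Fin (d + 1) → ℝ) (θ : 𝓢(ℝ, ℂ)) (F : Y d → ℂ) (x : E d) : ℂ :=
  ∫ y, integrandG α θ F x y ∂(measureY d)

lemma exists_norm_integrandG_le {d : ℕ} (α : Fin (d + 1) → ℝ) (θ : 𝓢(ℝ, ℂ)) :
    ∃ C, 0 ≤ C ∧ ∀ (F : Y d → ℂ) x y, ‖integrandG α θ F x y‖ ≤ C * ‖F y‖ := by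
  obtain ⟨C, hC, h⟩ := exists_bound θ
  refine ⟨C * ‖kernelConst α‖, by positivity, fun F x y => ?_⟩
  rw [integrandG, norm_mul, norm_mul, norm_kernel, mul_comm]
  gcongr
  exact h _

/-- Window and kernel are bounded and continuous, so the integrand inherits the decay of `F`. -/
lemma Rapid.integrandG {d : ℕ} {F : Y d → ℂ} (h : Rapid F) (α : Fin (d + 1) → ℝ) (θ : 𝓢(ℝ, ℂ))
    (x : E d) : Rapid (integrandG α θ F x) := by
  refine h.mul ((θ.continuous.comp (by fun_prop)).mul
    ((continuous_kernel α).comp (f := fun y : Y d => (x, y.2.2)) (by fun_prop))) ?_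
  obtain ⟨C, hC, hb⟩ := exists_norm_integrandG_le (d := d) α θ
  exact ⟨C, fun y => by simpa [DSTFRFT.integrandG] using hb (fun _ => 1) x y⟩

/-- Multiplication by the coordinate `u_k`. -/
def timesU {d : ℕ} (k : Fin (d + 1)) (F : Y d → ℂ) (y : Y d) : ℂ := ((y.1 : E d) k : ℂ) * F y

/-- Multiplication by the coordinate `a_k`. -/
def timesA {d : ℕ} (k : Fin (d + 1)) (F : Y d → ℂ) (y : Y d) : ℂ := (y.2.2 k : ℂ) * F y

/-- The derivative in `x` of the integrand of the synthesis operator. -/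
def derivIntegrandG {d : ℕ} (α : Fin (d + 1) → ℝ) (θ : 𝓢(ℝ, ℂ)) (F : Y d → ℂ) (x : E d) (y : Y d) :
    E d →L[ℝ] ℂ :=
  ∑ k, (integrandG α (derivT θ) (timesU k F) x y +
    (Complex.I * ((x k * Real.cot (α k) : ℝ) : ℂ) * integrandG α θ F x y -
      Complex.I * ((Real.sin (α k))⁻¹ : ℝ) * integrandG α θ (timesA k F) x y)) • coordC k

/-- The derivative of the synthesis operator. -/
def derivG {d : ℕ} (α : Fin (d + 1) → ℝ) (θ : 𝓢(ℝ, ℂ)) (F : Y d → ℂ) (k : Fin (d + 1)) (x : E d) :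
    ℂ :=
  G α (derivT θ) (timesU k F) x +
    (Complex.I * ((x k * Real.cot (α k) : ℝ) : ℂ) * G α θ F x -
      Complex.I * ((Real.sin (α k))⁻¹ : ℝ) * G α θ (timesA k F) x)

lemma hasFDerivAt_integrandG {d : ℕ} (α : Fin (d + 1) → ℝ) (θ : 𝓢(ℝ, ℂ)) (F : Y d → ℂ) (x : E d)
    (y : Y d) : HasFDerivAt (fun x => integrandG α θ F x y) (derivIntegrandG α θ F x y) x := by
  have h1 : HasFDerivAt (fun x : E d => θ (⟪(y.1 : E d), x⟫_ℝ - y.2.1)) _ x :=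
    (hasDerivAt_derivT θ (⟪(y.1 : E d), x⟫_ℝ - y.2.1)).hasFDerivAt.comp x
      ((innerSL ℝ (y.1 : E d)).hasFDerivAt.sub_const y.2.1)
  have h2 := hasFDerivAt_kernel α y.2.2 x
  simp only [kernel_comm α y.2.2] at h2
  convert! (h1.mul h2).const_mul (F y) using 1
  ext v
  simp [derivIntegrandG, integrandG, timesU, timesA, inner_eq_sum, Finset.mul_sum,
    ← Finset.sum_add_distrib]
  exact Finset.sum_congr rfl fun k _ => by ring

lemma Rapid.timesU {d : ℕ} {F : Y d → ℂ} (h : Rapid F) (k : Fin (d + 1)) : Rapid (timesU k F) := by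
  have := h.mul (m := fun y => ((y.1 : E d) k : ℂ)) (by fun_prop)
    ⟨1, fun y => norm_apply_sphere_le_one y.1 k⟩
  convert! this using 1
  exact funext fun y => mul_comm _ _

lemma integrable_integrandG {d : ℕ} (α : Fin (d + 1) → ℝ) (θ : 𝓢(ℝ, ℂ)) {F : Y d → ℂ}
    (h : Rapid F) (x : E d) : Integrable (integrandG α θ F x) (measureY d) :=
  (h.integrandG α θ x).integrable

/-- Differentiation under the integral sign. The kernel produces a factor `a_k`, hence the decay
required of `a_k F`. -/
lemma hasFDerivAt_G {d : ℕ} (α : Fin (d + 1) → ℝ) (θ : 𝓢(ℝ, ℂ)) {F : Y d → ℂ}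
    (hF : Rapid F) (hA : ∀ k, Rapid (timesA k F)) (x : E d) :
    HasFDerivAt (G α θ F) (∑ k, derivG α θ F k x • coordC k) x := by
  have e : ∑ k, derivG α θ F k x • coordC k = ∫ y, derivIntegrandG α θ F x y ∂(measureY d) := by
    unfold derivIntegrandG derivG G
    rw [integral_finsetSum]
    · refine Finset.sum_congr rfl fun k _ => ?_
      rw [integral_smul_const, integral_add, integral_sub, integral_const_mul, integral_const_mul]
      · exact (integrable_integrandG α _ hF x).const_mul _
      · exact (integrable_integrandG α _ (hA k) x).const_mul _
      · exact integrable_integrandG α _ (hF.timesU k) x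
      · exact ((integrable_integrandG α _ hF x).const_mul _).sub
          ((integrable_integrandG α _ (hA k) x).const_mul _)
    · exact fun k _ => ((integrable_integrandG α _ (hF.timesU k) x).add
        (((integrable_integrandG α _ hF x).const_mul _).sub
          ((integrable_integrandG α _ (hA k) x).const_mul _))).smul_const _
  rw [e]
  obtain ⟨C, hC, hθ⟩ := exists_norm_integrandG_le (d := d) α θ
  obtain ⟨C', hC', hθ'⟩ := exists_norm_integrandG_le (d := d) α (derivT θ)
  refine hasFDerivAt_integral_of_dominated_of_fderiv_le (Metric.ball_mem_nhds x one_pos)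
    (bound := fun y => ∑ k, (C' * ‖timesU k F y‖ + (((‖x‖ + 1) * |Real.cot (α k)|) * (C * ‖F y‖) +
        |(Real.sin (α k))⁻¹| * (C * ‖timesA k F y‖))) * ‖(coordC k : E d →L[ℝ] ℂ)‖)
    (.of_forall fun x => (hF.integrandG α θ x).cont.aestronglyMeasurable)
    (integrable_integrandG α θ hF x) ?_ (.of_forall fun y x' hx' => ?_) ?_
    (.of_forall fun y x' _ => hasFDerivAt_integrandG α θ F x' y)
  · refine Continuous.aestronglyMeasurable ?_
    unfold derivIntegrandG
    have h1 := fun k => ((hF.timesU k).integrandG α (derivT θ) x).cont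
    have h2 := (hF.integrandG α θ x).cont
    have h3 := fun k => ((hA k).integrandG α θ x).cont
    fun_prop
  · have hq : ∀ k, |x' k| ≤ ‖x‖ + 1 := fun k => by
      have h1 : |x' k| ≤ ‖x'‖ := PiLp.norm_apply_le x' k
      have h3 : ‖x' - x‖ < 1 := by simpa [dist_eq_norm] using hx'
      have h4 : ‖x'‖ ≤ ‖x‖ + ‖x' - x‖ := by
        simpa using norm_add_le x (x' - x)
      linarith
    refine (norm_sum_le _ _).trans (Finset.sum_le_sum fun k _ => ?_)
    rw [norm_smul]
    gcongr
    refine (norm_add_le _ _).trans (add_le_add (hθ' _ _ _)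
      ((norm_sub_le _ _).trans (add_le_add ?_ ?_)))
    · rw [norm_mul, norm_mul, Complex.norm_I, one_mul, Complex.norm_real, Real.norm_eq_abs,
        abs_mul]
      gcongr
      · exact hq k
      · exact hθ _ _ _
    · rw [norm_mul, norm_mul, Complex.norm_I, one_mul, Complex.norm_real, Real.norm_eq_abs]
      gcongr
      exact hθ _ _ _
  · refine integrable_finsetSum _ fun k _ => Integrable.mul_const ?_ _
    exact ((hF.timesU k).integrable.norm.const_mul _).add
      (((hF.integrable.norm.const_mul _).const_mul _).add
        (((hA k).integrable.norm.const_mul _).const_mul _))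

/-- Multiplication of the synthesis operator by `x_k`. -/
lemma mulX_G {d : ℕ} {α : Fin (d + 1) → ℝ} (hα : ∀ k, Real.sin (α k) ≠ 0) (k : Fin (d + 1))
    (θ : 𝓢(ℝ, ℂ)) {F : Y d → ℂ} (hs : IsSmoothY F) (hF : Rapid F) (hA : Rapid (timesA k F))
    (hD : Rapid (partialA k F)) (x : E d) :
    (x k : ℂ) * G α θ F x = -Complex.I * (Real.sin (α k) : ℂ) * G α θ (partialA k F) x +
      (Real.sin (α k) * Real.cot (α k) : ℝ) * G α θ (timesA k F) x := by
  -- This is the `a_k`-derivative of the integrand.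
  have hW' : Rapid (fun y => integrandG α θ (partialA k F) x y +
      (Complex.I * (Real.cot (α k) : ℝ) * integrandG α θ (timesA k F) x y +
        (-(Complex.I * ((x k * (Real.sin (α k))⁻¹ : ℝ) : ℂ))) * integrandG α θ F x y)) :=
    (hD.integrandG α θ x).add (((hA.integrandG α θ x).const_mul _).add
      ((hF.integrandG α θ x).const_mul _))
  -- The order with `a` innermost is chosen so that the inner integral is that of a derivative and
  -- vanishes.
  have h0 := hW'.integral_eq
  have hzero : ∀ (u : Sph d) (b : ℝ), ∫ a : E d, (integrandG α θ (partialA k F) x (u, b, a) +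
      (Complex.I * (Real.cot (α k) : ℝ) * integrandG α θ (timesA k F) x (u, b, a) +
        (-(Complex.I * ((x k * (Real.sin (α k))⁻¹ : ℝ) : ℂ))) *
          integrandG α θ F x (u, b, a))) = 0 := by
    intro u b
    refine integral_fderiv_eq_zero (W := fun a => integrandG α θ F x (u, b, a))
      (EuclideanSpace.single k 1) (fun a => ?_) ((hF.integrandG α θ x).integrable_sliceA u b)
      (hW'.integrable_sliceA u b)
    have h1 : HasFDerivAt (fun a : E d => F (u, b, a)) _ a :=
      (((contDiff_sliceA hs u b).contDiffAt (x := a)).differentiableAt (by simp)).hasFDerivAt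
    have h3 := (h1.mul ((hasFDerivAt_kernel α x a).const_mul
      (θ (⟪(u : E d), x⟫_ℝ - b)))).hasLineDerivAt (EuclideanSpace.single k 1)
    convert! h3 using 1
    simp only [add_apply, smul_apply, sum_smul_coordC_single, smul_eq_mul]
    rw [← partialA_eq_fderiv hs k (u, b, a)]
    simp only [integrandG, timesA]
    push_cast
    ring
  simp only [hzero, integral_zero] at h0
  rw [integral_add, integral_add] at h0
  rotate_left
  · exact (integrable_integrandG α θ hA x).const_mul _
  · exact (integrable_integrandG α θ hF x).const_mul _
  · exact integrable_integrandG α θ hD x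
  · exact ((integrable_integrandG α θ hA x).const_mul _).add
      ((integrable_integrandG α θ hF x).const_mul _)
  simp only [integral_const_mul] at h0
  change G α θ (partialA k F) x + (Complex.I * (Real.cot (α k) : ℝ) * G α θ (timesA k F) x +
    (-(Complex.I * ((x k * (Real.sin (α k))⁻¹ : ℝ) : ℂ))) * G α θ F x) = 0 at h0
  have hs : (Real.sin (α k) : ℂ) * ((Real.sin (α k))⁻¹ : ℝ) = 1 := by
    rw [← Complex.ofReal_mul, mul_inv_cancel₀ (hα k), Complex.ofReal_one]
  push_cast [-Complex.ofReal_sin, -Complex.ofReal_cot, -Complex.ofReal_inv] at h0 ⊢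
  have hI := Complex.I_mul_I
  -- As for the transform, multiplication by `i sin α_k` isolates the term with `x_k`.
  linear_combination ((Real.sin (α k) : ℂ) * Complex.I) * h0 -
    (x k : ℂ) * G α θ F x * hs +
    (- (Real.sin (α k) : ℂ) * Real.cot (α k) * G α θ (timesA k F) x +
      (Real.sin (α k) : ℂ) * ((Real.sin (α k))⁻¹ : ℝ) * (x k : ℂ) * G α θ F x) * hI

/-! ### Schwartz functions from classes stable under multiplication and differentiation -/

section Stable

variable {d : ℕ} {X : Type*} [AddCommGroup X] [Module ℂ X] [TopologicalSpace X]

/-- A class of families of functions on `ℝⁿ` that is stable under multiplication by coordinates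
and under partial derivatives, and whose members are bounded by continuous seminorms. -/
structure IsStable (P : (X → E d → ℂ) → Prop) : Prop where
  mul : ∀ L, P L → ∀ k, P (fun Φ x => (x k : ℂ) * L Φ x)
  deriv : ∀ L, P L → ∃ L' : Fin (d + 1) → X → E d → ℂ, (∀ k, P (L' k)) ∧
    ∀ Φ x, HasFDerivAt (L Φ) (∑ k, L' k Φ x • coordC k) x
  bdd : ∀ L, P L → SeminormBdd (fun Φ x => ‖L Φ x‖)

variable {P : (X → E d → ℂ) → Prop}

/-- Bootstrapping: the partial derivatives are again members of the class. -/
lemma IsStable.contDiff (hP : IsStable P) {L : X → E d → ℂ} (h : P L) (Φ : X) :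
    ContDiff ℝ ∞ (L Φ) := by
  rw [contDiff_infty]
  intro n
  induction n generalizing L with
  | zero =>
    obtain ⟨L', -, e⟩ := hP.deriv L h
    exact contDiff_zero.2 (continuous_iff_continuousAt.2 fun x => (e Φ x).continuousAt)
  | succ n ih =>
    obtain ⟨L', hL', e⟩ := hP.deriv L h
    push_cast
    rw [contDiff_succ_iff_fderiv]
    refine ⟨fun x => (e Φ x).differentiableAt, by simp, ?_⟩
    rw [funext fun x => (e Φ x).fderiv]
    exact ContDiff.sum fun k _ => (ih (hL' k)).smul contDiff_const

lemma norm_le_sum_norm {d : ℕ} (x : E d) : ‖x‖ ≤ ∑ k, ‖(x k : ℂ)‖ := by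
  conv_lhs => rw [eq_sum_single x]
  refine (norm_sum_le _ _).trans (Finset.sum_le_sum fun k _ => ?_)
  simp [norm_smul]

/-- Each factor `‖x‖` is at most `∑ |x_k|`, and multiplication by `x_k` stays in the class. -/
lemma IsStable.seminormBdd_pow (hP : IsStable P) (j : ℕ) {L : X → E d → ℂ} (h : P L) :
    SeminormBdd (fun Φ x => ‖x‖ ^ j * ‖L Φ x‖) := by
  induction j generalizing L with
  | zero => simpa using hP.bdd L h
  | succ j ih =>
    refine (SeminormBdd.sum (s := Finset.univ) fun k => ih (hP.mul L h k)).mono fun Φ x => ?_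
    calc ‖x‖ ^ (j + 1) * ‖L Φ x‖ = ‖x‖ ^ j * ‖x‖ * ‖L Φ x‖ := by ring
      _ ≤ ‖x‖ ^ j * (∑ k, ‖(x k : ℂ)‖) * ‖L Φ x‖ := by gcongr; exact norm_le_sum_norm x
      _ = ∑ k, ‖x‖ ^ j * ‖(x k : ℂ) * L Φ x‖ := by
        rw [Finset.mul_sum, Finset.sum_mul]
        exact Finset.sum_congr rfl fun k _ => by rw [norm_mul]; ring

/-- The multiples of a complex valued covector. -/
def smulCovector {d : ℕ} (ℓ : E d →L[ℝ] ℂ) : ℂ →L[ℝ] E d →L[ℝ] ℂ :=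
  (ContinuousLinearMap.lsmul ℝ ℂ : ℂ →L[ℝ] (E d →L[ℝ] ℂ) →L[ℝ] (E d →L[ℝ] ℂ)).flip ℓ

@[simp] lemma smulCovector_apply {d : ℕ} (ℓ : E d →L[ℝ] ℂ) (c : ℂ) :
    smulCovector ℓ c = c • ℓ := rfl

/-- The derivative of order `n + 1` is the `n`-th one of `∑ L'_k • coordC k`, a sum of members of
the class followed by fixed linear maps. With `IsStable.contDiff` this gives all the Schwartz
bounds. -/
lemma IsStable.seminormBdd_iteratedFDeriv (hP : IsStable P) (j n : ℕ) {L : X → E d → ℂ}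
    (h : P L) : SeminormBdd (fun Φ x => ‖x‖ ^ j * ‖iteratedFDeriv ℝ n (L Φ) x‖) := by
  induction n generalizing L with
  | zero => simpa using hP.seminormBdd_pow j h
  | succ n ih =>
    obtain ⟨L', hL', e⟩ := hP.deriv L h
    refine (SeminormBdd.sum (s := Finset.univ) fun k => (ih (hL' k)).const_mul
      (norm_nonneg (smulCovector (coordC k : E d →L[ℝ] ℂ)))).mono
      fun Φ x => ?_
    rw [← norm_iteratedFDeriv_fderiv, funext fun x => (e Φ x).fderiv]
    have hc : ∀ k, ContDiffAt ℝ n (L' k Φ) x := fun k =>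
      ((hP.contDiff (hL' k) Φ).of_le (mod_cast le_top)).contDiffAt
    have e1 : (fun x => ∑ k, L' k Φ x • (coordC k : E d →L[ℝ] ℂ)) = ∑ k,
        (smulCovector (coordC k : E d →L[ℝ] ℂ)) ∘ L' k Φ := by
      funext x
      simp
    rw [e1, iteratedFDeriv_sum_apply fun k _ => (smulCovector _).contDiff.contDiffAt.comp x (hc k)]
    refine (mul_le_mul_of_nonneg_left (norm_sum_le _ _) (by positivity)).trans ?_
    rw [Finset.mul_sum]
    refine Finset.sum_le_sum fun k _ => ?_
    rw [mul_left_comm]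
    gcongr
    exact (smulCovector _).norm_iteratedFDeriv_comp_left (hc k) le_rfl

end Stable

/-- The functions of `x` depending linearly on `Φ` generated by the synthesis operator. -/
inductive GeneratedX {d : ℕ} (α : Fin (d + 1) → ℝ) : (SchwartzY d → E d → ℂ) → Prop
  | base (S) (hS : CoeffOp S) (θ : 𝓢(ℝ, ℂ)) : GeneratedX α (fun Φ x => G α θ (S Φ) x)
  | add (L L') : GeneratedX α L → GeneratedX α L' → GeneratedX α (fun Φ x => L Φ x + L' Φ x)
  | const_mul (c : ℂ) (L) : GeneratedX α L → GeneratedX α (fun Φ x => c * L Φ x)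

lemma GeneratedX.mulX {d : ℕ} {α : Fin (d + 1) → ℝ} (hα : ∀ k, Real.sin (α k) ≠ 0)
    {L : SchwartzY d → E d → ℂ} (h : GeneratedX α L) (k : Fin (d + 1)) :
    GeneratedX α (fun Φ x => (x k : ℂ) * L Φ x) := by
  induction h with
  | base S hS θ =>
    convert! ((base _ (hS.partialA k) θ).const_mul (-Complex.I * (Real.sin (α k) : ℂ)) _).add _ _
      ((base _ (hS.mulA _ k) θ).const_mul (Real.sin (α k) * Real.cot (α k) : ℝ) _) using 1
    funext Φ x
    exact mulX_G hα k θ (hS.isSmoothY Φ) (hS.rapid Φ) ((hS.mulA _ k).rapid Φ)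
      ((hS.partialA k).rapid Φ) x
  | add L L' _ _ ih ih' =>
    convert! ih.add _ _ ih' using 1
    funext Φ x
    ring
  | const_mul c L _ ih =>
    convert! ih.const_mul c _ using 1
    funext Φ x
    ring

lemma seminormBdd_integral_norm_coeffOp {d : ℕ} {S : SchwartzY d → Y d → ℂ} (hS : CoeffOp S) :
    SeminormBdd (fun Φ (_ : E d) => ∫ y, ‖S Φ y‖ ∂(measureY d)) := by
  obtain ⟨p, hp, hb⟩ := (hS.seminormBdd 1 (d + 1))
  refine SeminormBdd.mono (B := fun Φ _ => (∫ y : Y d, decay y.2 ∂(measureY d)) * p Φ)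
    (SeminormBdd.const_mul ⟨p, hp, fun _ _ => le_rfl⟩ (integral_nonneg fun y => ?_)) fun Φ x => ?_
  · unfold decay
    positivity
  · rw [mul_comm, ← integral_const_mul]
    exact integral_mono (hS.rapid Φ).integrable.norm
      (((integrable_decay d).comp_snd (sphereMeasure d)).const_mul _) (norm_le_of_weight_le (hb Φ))

/-- Differentiation produces the factors `u_k`, `a_k` and `x_k`. The first two are absorbed into the
operator on `Φ`, the last is removed by `GeneratedX.mulX`. -/
lemma isStable_generatedX {d : ℕ} {α : Fin (d + 1) → ℝ} (hα : ∀ k, Real.sin (α k) ≠ 0) :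
    IsStable (GeneratedX α) where
  mul L h k := h.mulX hα k
  deriv L h := by
    induction h with
    | base S hS θ =>
      refine ⟨fun k => _, fun k => ((GeneratedX.base _ (hS.mulU _ k) (derivT θ)).add _ _
        ((((GeneratedX.base _ hS θ).mulX hα k).const_mul (Complex.I * Real.cot (α k)) _).add _ _
        ((GeneratedX.base _ (hS.mulA _ k) θ).const_mul
          (-(Complex.I * ((Real.sin (α k))⁻¹ : ℝ))) _))), fun Φ x => ?_⟩
      convert! hasFDerivAt_G α θ (hS.rapid Φ) (fun k => (hS.mulA _ k).rapid Φ) x using 1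
      refine Finset.sum_congr rfl fun k _ => ?_
      congr 1
      simp only [derivG]
      push_cast
      change G α (derivT θ) (timesU k (S Φ)) x + (_ + _ * G α θ (timesA k (S Φ)) x) = _
      ring
    | add L L' h h' ih ih' =>
      obtain ⟨M, hM, e⟩ := ih
      obtain ⟨M', hM', e'⟩ := ih'
      refine ⟨_, fun k => (hM k).add _ _ (hM' k), fun Φ x => ?_⟩
      convert! (e Φ x).add (e' Φ x) using 1
      rw [← Finset.sum_add_distrib]
      exact Finset.sum_congr rfl fun k _ => by ext v; simp [add_mul]
    | const_mul c L h ih =>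
      obtain ⟨M, hM, e⟩ := ih
      refine ⟨_, fun k => (hM k).const_mul c _, fun Φ x => ?_⟩
      convert! (e Φ x).const_mul c using 1
      rw [Finset.smul_sum]
      exact Finset.sum_congr rfl fun k _ => mul_smul _ _ _
  bdd L h := by
    induction h with
    | base S hS θ =>
      obtain ⟨C, hC, h⟩ := exists_norm_integrandG_le (d := d) α θ
      refine ((seminormBdd_integral_norm_coeffOp hS).const_mul hC).mono fun Φ x => ?_
      rw [← integral_const_mul]
      exact norm_integral_le_of_norm_le ((hS.rapid Φ).integrable.norm.const_mul C)
        (.of_forall fun y => h (S Φ) x y)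
    | add L L' _ _ ih ih' => exact (ih.add ih').mono fun Φ x => norm_add_le _ _
    | const_mul c L _ ih => exact (ih.const_mul (norm_nonneg c)).mono fun Φ x => (norm_mul _ _).le

/-! ### The synthesis operator on test functions. -/

lemma G_add {d : ℕ} (α : Fin (d + 1) → ℝ) (θ : 𝓢(ℝ, ℂ)) {F F' : Y d → ℂ} (h : Rapid F)
    (h' : Rapid F') (x : E d) : G α θ (F + F') x = G α θ F x + G α θ F' x := by
  rw [G, G, G, ← integral_add (integrable_integrandG α θ h x) (integrable_integrandG α θ h' x)]
  congr 1
  funext y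
  simp [integrandG]
  ring

lemma G_smul {d : ℕ} (α : Fin (d + 1) → ℝ) (θ : 𝓢(ℝ, ℂ)) (c : ℂ) (F : Y d → ℂ) (x : E d) :
    G α θ (c • F) x = c * G α θ F x := by
  rw [G, G, ← integral_const_mul]
  congr 1
  funext y
  simp [integrandG]
  ring

lemma rapid_coe {d : ℕ} (Φ : SchwartzY d) : Rapid (Φ : Y d → ℂ) := CoeffOp.id.rapid Φ

/-- The synthesis operator as a continuous linear map `𝒮(𝕐²ⁿ) → 𝒮(ℝⁿ)`. -/
lemma exists_synthesisCLM {d : ℕ} {α : Fin (d + 1) → ℝ} (hα : ∀ k, Real.sin (α k) ≠ 0)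
    (θ : 𝓢(ℝ, ℂ)) : ∃ B : SchwartzY d →L[ℂ] 𝓢(E d, ℂ), ∀ Φ x, B Φ x = G α θ Φ x := by
  have hP := isStable_generatedX hα
  have hG : GeneratedX α (fun Φ x => G α θ Φ x) := GeneratedX.base _ CoeffOp.id θ
  let B : SchwartzY d →ₗ[ℂ] 𝓢(E d, ℂ) :=
    { toFun := fun Φ => ⟨fun x => G α θ Φ x, hP.contDiff hG Φ, fun k n => by
        obtain ⟨p, -, hp⟩ := hP.seminormBdd_iteratedFDeriv k n hG
        exact ⟨p Φ, hp Φ⟩⟩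
      map_add' := fun Φ Φ' => SchwartzMap.ext fun x => G_add α θ (rapid_coe Φ) (rapid_coe Φ') x
      map_smul' := fun c Φ => SchwartzMap.ext fun x => G_smul α θ c Φ x }
  have := isTopologicalAddGroup_schwartzY d
  refine ⟨⟨B, ?_⟩, fun Φ x => rfl⟩
  refine WithSeminorms.continuous_of_continuous_comp (schwartz_withSeminorms ℂ (E d) ℂ) B
    fun i => ?_
  obtain ⟨p, hp, hb⟩ := hP.seminormBdd_iteratedFDeriv i.1 i.2 hG
  refine Seminorm.continuous_of_le hp fun Φ => ?_
  exact SchwartzMap.seminorm_le_bound ℂ i.1 i.2 (B Φ) (apply_nonneg p Φ) (hb Φ)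

/-- Conjugation turns `K_{-α}` into `K_α` and puts the bar on the window; the decay of `F` permits
Fubini in the order `db da du`. -/
lemma conj_synthesis {d : ℕ} (α : Fin (d + 1) → ℝ) (ψ : 𝓢(ℝ, ℂ)) {F : Y d → ℂ} (hF : Rapid F)
    (x : E d) : conj (synthesis α ψ (fun y => conj (F y)) x) = G α (conjT ψ) F x := by
  rw [G, (hF.integrandG α (conjT ψ) x).integral_eq_symm, synthesis, ← integral_conj]
  simp_rw [← integral_conj]
  simp only [integrandG, map_mul, Complex.conj_conj, conj_kernel, neg_neg, conjT_apply, mul_assoc,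
    real_inner_comm x]

/-! ### Fourier inversion -/

/-- The diagonal linear map with nonzero entries `s`. -/
def diagEquiv {d : ℕ} (s : Fin (d + 1) → ℝ) (hs : ∀ k, s k ≠ 0) : E d ≃L[ℝ] E d :=
  LinearEquiv.toContinuousLinearEquiv
    { toFun := fun a => WithLp.toLp 2 fun k => s k * a k
      invFun := fun a => WithLp.toLp 2 fun k => (s k)⁻¹ * a k
      map_add' := fun a b => by ext k; simp [mul_add]
      map_smul' := fun c a => by ext k; simp [mul_left_comm]
      left_inv := fun a => by ext k; simp [hs k]
      right_inv := fun a => by ext k; simp [hs k] }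

@[simp] lemma diagEquiv_apply {d : ℕ} (s : Fin (d + 1) → ℝ) (hs : ∀ k, s k ≠ 0) (a : E d)
    (k : Fin (d + 1)) : diagEquiv s hs a k = s k * a k := rfl

lemma det_diagEquiv {d : ℕ} (s : Fin (d + 1) → ℝ) (hs : ∀ k, s k ≠ 0) :
    LinearMap.det ((diagEquiv s hs).toLinearEquiv : E d →ₗ[ℝ] E d) = ∏ k, s k := by
  rw [← LinearMap.det_toMatrix (EuclideanSpace.basisFun (Fin (d + 1)) ℝ).toBasis]
  have : LinearMap.toMatrix (EuclideanSpace.basisFun (Fin (d + 1)) ℝ).toBasis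
      (EuclideanSpace.basisFun (Fin (d + 1)) ℝ).toBasis
      ((diagEquiv s hs).toLinearEquiv : E d →ₗ[ℝ] E d) = Matrix.diagonal s := by
    ext i j
    rw [LinearMap.toMatrix_apply]
    by_cases h : i = j
    · subst h; simp
    · simp [h]
  rw [this, Matrix.det_diagonal]

lemma map_diagEquiv {d : ℕ} (s : Fin (d + 1) → ℝ) (hs : ∀ k, s k ≠ 0) :
    Measure.map (diagEquiv s hs) (volume : Measure (E d)) =
      ENNReal.ofReal |(∏ k, s k)⁻¹| • volume := by
  have := Measure.map_linearMap_addHaar_eq_smul_addHaar (volume : Measure (E d))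
    (f := ((diagEquiv s hs).toLinearEquiv : E d →ₗ[ℝ] E d))
    (by rw [det_diagEquiv]; exact Finset.prod_ne_zero_iff.2 fun k _ => hs k)
  rw [det_diagEquiv] at this
  exact this

lemma integrable_comp_diagEquiv {d : ℕ} {s : Fin (d + 1) → ℝ} (hs : ∀ k, s k ≠ 0) {f : E d → ℂ} :
    Integrable (fun a => f (diagEquiv s hs a)) ↔ Integrable f := by
  have h := (diagEquiv s hs).toHomeomorph.measurableEmbedding.integrable_map_iff
    (μ := (volume : Measure (E d))) (g := f)
  rw [show ⇑(diagEquiv s hs).toHomeomorph = diagEquiv s hs from rfl, map_diagEquiv,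
    integrable_smul_measure] at h
  · exact h.symm
  · simpa [Finset.prod_eq_zero_iff] using hs
  · exact ENNReal.ofReal_ne_top

lemma integral_comp_diagEquiv {d : ℕ} {s : Fin (d + 1) → ℝ} (hs : ∀ k, s k ≠ 0) (f : E d → ℂ) :
    ∫ a, f (diagEquiv s hs a) = ((∏ k, |s k|⁻¹ : ℝ) : ℂ) * ∫ w, f w := by
  have h := (diagEquiv s hs).toHomeomorph.measurableEmbedding.integral_map
    (μ := (volume : Measure (E d))) f
  rw [show ⇑(diagEquiv s hs).toHomeomorph = diagEquiv s hs from rfl, map_diagEquiv,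
    integral_smul_measure, ENNReal.toReal_ofReal (abs_nonneg _)] at h
  rw [← h, Complex.real_smul, ← Finset.prod_inv_distrib, Finset.abs_prod]
  simp only [abs_inv]

/-- The product is the squared modulus of the constant, and `|1 - i cot α_k| = 1 / |sin α_k|`
because `1 + cot² = 1 / sin²`. -/
lemma conj_kernelConst_mul {d : ℕ} {α : Fin (d + 1) → ℝ} (hα : ∀ k, Real.sin (α k) ≠ 0) :
    kernelConst (-α) * kernelConst α =
      ((∏ k, (2 * Real.pi * |Real.sin (α k)|)⁻¹ : ℝ) : ℂ) := by
  rw [← conj_kernelConst, mul_comm, Complex.mul_conj, Complex.normSq_eq_norm_sq, kernelConst,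
    norm_prod, ← Finset.prod_pow]
  congr 1
  refine Finset.prod_congr rfl fun k _ => ?_
  rw [← norm_pow]
  have h2 : ∀ z : ℂ, (z ^ (1 / 2 : ℂ)) ^ 2 = z := fun z => by
    simp
  rw [h2, norm_div, norm_mul, Complex.norm_real, Real.norm_of_nonneg Real.pi_pos.le]
  have h3 : ‖1 - Complex.I * (Real.cot (α k) : ℂ)‖ = |Real.sin (α k)|⁻¹ := by
    rw [← abs_inv, ← abs_of_nonneg (norm_nonneg (1 - Complex.I * (Real.cot (α k) : ℂ))),
      ← sq_eq_sq_iff_abs_eq_abs, ← Complex.normSq_eq_norm_sq, Complex.normSq_apply]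
    have hre : (1 - Complex.I * (Real.cot (α k) : ℂ)).re = 1 := by
      simp [-Complex.ofReal_cot]
    have him : (1 - Complex.I * (Real.cot (α k) : ℂ)).im = -Real.cot (α k) := by
      simp [-Complex.ofReal_cot]
    rw [hre, him, Real.cot_eq_cos_div_sin]
    field_simp [hα k]
    nlinarith [Real.sin_sq_add_cos_sq (α k)]
  rw [h3]
  simp [div_eq_mul_inv, mul_comm]

/-- The chirp phase. -/
def chirp {d : ℕ} (α : Fin (d + 1) → ℝ) (x : E d) : ℝ := ∑ k, x k ^ 2 / 2 * Real.cot (α k)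

/-- The frequencies of the kernel. -/
def freq {d : ℕ} (α : Fin (d + 1) → ℝ) (k : Fin (d + 1)) : ℝ :=
  -((Real.sin (α k))⁻¹ / (2 * Real.pi))

lemma freq_ne_zero {d : ℕ} {α : Fin (d + 1) → ℝ} (hα : ∀ k, Real.sin (α k) ≠ 0)
    (k : Fin (d + 1)) : freq α k ≠ 0 :=
  neg_ne_zero.2 (div_ne_zero (inv_ne_zero (hα k)) (by positivity))

/-- Up to a chirp in each variable the kernel is a Fourier kernel at a rescaled frequency. -/
lemma phase_eq {d : ℕ} {α : Fin (d + 1) → ℝ} (hα : ∀ k, Real.sin (α k) ≠ 0) (x a : E d) :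
    phase α x a = chirp α x + chirp α a +
      2 * Real.pi * ⟪x, diagEquiv (freq α) (freq_ne_zero hα) a⟫_ℝ := by
  rw [inner_eq_sum, phase, chirp, chirp, Finset.mul_sum, ← Finset.sum_add_distrib,
    ← Finset.sum_add_distrib]
  refine Finset.sum_congr rfl fun k _ => ?_
  have := Real.pi_pos.ne'
  have := hα k
  simp only [diagEquiv_apply, freq]
  field_simp
  ring

/-- Inversion of the fractional Fourier transform. -/
lemma kernel_inversion {d : ℕ} {α : Fin (d + 1) → ℝ} (hα : ∀ k, Real.sin (α k) ≠ 0) {h : E d → ℂ}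
    (hc : Continuous h) (hi : Integrable h)
    (hg : Integrable fun a => ∫ y, h y * kernel (-α) y a) (x : E d) :
    ∫ a, (∫ y, h y * kernel (-α) y a) * kernel α x a = h x := by
  have hC0 : kernelConst (-α) * kernelConst α ≠ 0 := by
    rw [conj_kernelConst_mul hα]
    refine Complex.ofReal_ne_zero.2 (Finset.prod_ne_zero_iff.2 fun k _ => inv_ne_zero ?_)
    have := hα k
    positivity
  set D := diagEquiv (freq α) (freq_ne_zero hα) with hD
  -- The chirp in `y` is absorbed into the input, so that the fractional transform of `h` becomes a
  -- chirped and rescaled Fourier transform of `f`.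
  let f : E d → ℂ := fun y => h y * Complex.exp (((-chirp α y : ℝ) : ℂ) * Complex.I)
  have hchirp : Continuous (chirp (d := d) α) := by unfold chirp; fun_prop
  have hfc : Continuous f := hc.mul (by fun_prop)
  have hfi : Integrable f := by
    refine hi.norm.mono' hfc.aestronglyMeasurable (.of_forall fun y => le_of_eq ?_)
    rw [norm_mul, Complex.norm_exp_ofReal_mul_I, mul_one]
  have hgF : ∀ a, ∫ y, h y * kernel (-α) y a = kernelConst (-α) *
      Complex.exp (((-chirp α a : ℝ) : ℂ) * Complex.I) * FourierTransform.fourier f (D a) := by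
    intro a
    rw [Real.fourier_eq', ← integral_const_mul]
    congr 1
    funext y
    rw [kernel_eq, phase_neg, phase_eq hα, smul_eq_mul]
    have e : Complex.exp (Complex.I * ((-(chirp α y + chirp α a +
        2 * Real.pi * ⟪y, diagEquiv (freq α) (freq_ne_zero hα) a⟫_ℝ) : ℝ) : ℂ)) =
        Complex.exp (((-chirp α a : ℝ) : ℂ) * Complex.I) *
        (Complex.exp ((-2 * Real.pi * ⟪y, D a⟫_ℝ : ℝ) * Complex.I) *
          Complex.exp (((-chirp α y : ℝ) : ℂ) * Complex.I)) := by
      rw [← Complex.exp_add, ← Complex.exp_add]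
      congr 1
      push_cast
      ring
    rw [e]
    simp only [f]
    ring
  -- Integrability transfers from `hg`: the chirp is unimodular, the constant nonzero and the
  -- rescaling invertible.
  have hFi : Integrable (FourierTransform.fourier f) := by
    rw [← integrable_comp_diagEquiv (freq_ne_zero hα)]
    have h1 : Integrable fun a => (kernelConst (-α))⁻¹ *
        (Complex.exp (((chirp α a : ℝ) : ℂ) * Complex.I) * ∫ y, h y * kernel (-α) y a) := by
      refine Integrable.const_mul (hg.norm.mono' ?_ (.of_forall fun a => le_of_eq ?_)) _
      · exact (Continuous.aestronglyMeasurable (by fun_prop)).mul hg.aestronglyMeasurable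
      · rw [norm_mul, Complex.norm_exp_ofReal_mul_I, one_mul]
    convert! h1 using 1
    funext a
    rw [hgF]
    have e : Complex.exp (((chirp α a : ℝ) : ℂ) * Complex.I) *
        Complex.exp (((-chirp α a : ℝ) : ℂ) * Complex.I) = 1 := by
      rw [← Complex.exp_add]; simp
    have hne := left_ne_zero_of_mul hC0
    calc FourierTransform.fourier f (D a) = ((kernelConst (-α))⁻¹ * kernelConst (-α)) *
          (Complex.exp (((chirp α a : ℝ) : ℂ) * Complex.I) *
        Complex.exp (((-chirp α a : ℝ) : ℂ) * Complex.I)) * FourierTransform.fourier f (D a) := by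
          rw [e, inv_mul_cancel₀ hne]; ring
      _ = _ := by ring
  have hinv := congrFun (hfc.fourierInv_fourier_eq hfi hFi) x
  rw [Real.fourierInv_eq'] at hinv
  -- The chirps in `a` of `K_{-α}` and `K_α` cancel, which leaves the integrand of the inverse
  -- Fourier transform.
  have key : ∀ a, (∫ y, h y * kernel (-α) y a) * kernel α x a =
      (kernelConst (-α) * kernelConst α * Complex.exp ((chirp α x : ℝ) * Complex.I)) *
        (Complex.exp ((2 * Real.pi * ⟪D a, x⟫_ℝ : ℝ) * Complex.I) •
          FourierTransform.fourier f (D a)) := by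
    intro a
    rw [hgF, kernel_eq, phase_eq hα, smul_eq_mul, real_inner_comm, ← hD]
    have e : Complex.exp (((-chirp α a : ℝ) : ℂ) * Complex.I) *
        Complex.exp (Complex.I * ((chirp α x + chirp α a + 2 * Real.pi * ⟪D a, x⟫_ℝ : ℝ) : ℂ)) =
        Complex.exp ((chirp α x : ℝ) * Complex.I) *
          Complex.exp ((2 * Real.pi * ⟪D a, x⟫_ℝ : ℝ) * Complex.I) := by
      rw [← Complex.exp_add, ← Complex.exp_add]
      congr 1
      push_cast
      ring
    linear_combination kernelConst (-α) * kernelConst α * FourierTransform.fourier f (D a) * e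
  simp_rw [key]
  rw [integral_const_mul, integral_comp_diagEquiv (freq_ne_zero hα) (fun w =>
    Complex.exp ((2 * Real.pi * ⟪w, x⟫_ℝ : ℝ) * Complex.I) • FourierTransform.fourier f w), hinv,
    conj_kernelConst_mul hα]
  -- The Jacobian of the rescaling is the inverse of the squared modulus of the kernel constant.
  have hprod : (∏ k, (2 * Real.pi * |Real.sin (α k)|)⁻¹ : ℝ) * ∏ k, |freq α k|⁻¹ = 1 := by
    rw [← Finset.prod_mul_distrib]
    refine Finset.prod_eq_one fun k _ => ?_
    have h1 : |Real.sin (α k)| ≠ 0 := abs_ne_zero.2 (hα k)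
    have := Real.pi_pos.ne'
    rw [freq, abs_neg, abs_div, abs_inv, abs_of_pos Real.two_pi_pos]
    field_simp
  have hprod' := congrArg (fun t : ℝ => (t : ℂ)) hprod
  simp only [Complex.ofReal_mul, Complex.ofReal_one] at hprod'
  have e : Complex.exp ((chirp α x : ℝ) * Complex.I) *
      Complex.exp (((-chirp α x : ℝ) : ℂ) * Complex.I) = 1 := by
    rw [← Complex.exp_add]; simp
  simp only [f]
  linear_combination (h x * (((∏ k, (2 * Real.pi * |Real.sin (α k)|)⁻¹ : ℝ) : ℂ) *
    ((∏ k, |freq α k|⁻¹ : ℝ) : ℂ))) * e + h x * hprod'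

/-! ### The reconstruction formula -/

/-- Integrating in `a` first inverts the fractional Fourier transform for fixed `(u, b)`; what
remains depends on `b` only through the two windows. -/
lemma G_conjT_analysis {d : ℕ} {α : Fin (d + 1) → ℝ} (hα : ∀ k, Real.sin (α k) ≠ 0)
    (ψ η : 𝓢(ℝ, ℂ)) (φ : 𝓢(E d, ℂ)) (Φ : SchwartzY d)
    (hΦ : ∀ y, Φ y = J (-α) φ η ((y.1 : E d), y.2)) (x : E d) :
    G α (conjT ψ) Φ x = windowInner η ψ * φ x := by
  have hR := rapid_coe Φ
  rw [G, (hR.integrandG α (conjT ψ) x).integral_eq]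
  have h1 : ∀ (u : Sph d) (b : ℝ), ∫ a : E d, integrandG α (conjT ψ) Φ x (u, b, a) =
      (fun t => φ x * (η t * conj (ψ t))) (⟪(u : E d), x⟫_ℝ - b) := by
    intro u b
    let h : E d → ℂ := fun y => φ y * η (⟪(u : E d), y⟫_ℝ - b)
    have hJ : ∀ a, ∫ y, h y * kernel (-α) y a = Φ (u, b, a) := fun a => (hΦ (u, b, a)).symm
    have hc : Continuous h := φ.continuous.mul (η.continuous.comp (by fun_prop))
    have hi : Integrable h := by
      obtain ⟨C, -, hC⟩ := exists_bound η
      refine (φ.integrable.norm.const_mul C).mono' hc.aestronglyMeasurable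
        (.of_forall fun y => ?_)
      rw [norm_mul, mul_comm]
      exact mul_le_mul_of_nonneg_right (hC _) (norm_nonneg _)
    have := kernel_inversion hα hc hi (by simpa only [hJ] using hR.integrable_sliceA u b) x
    simp only [hJ] at this
    have e : ∀ a, integrandG α (conjT ψ) Φ x (u, b, a) =
        conj (ψ (⟪(u : E d), x⟫_ℝ - b)) * (Φ (u, b, a) * kernel α x a) := fun a => by
      simp only [integrandG, conjT_apply]
      ring
    simp_rw [e]
    rw [integral_const_mul, this]
    simp only [h]
    ring
  simp_rw [h1]
  -- Reflection and translation invariance in `b` remove the dependence on `u`, so the integral over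
  -- the probability space of directions is trivial.
  have h2 : ∀ u : Sph d, ∫ b : ℝ, (fun t => φ x * (η t * conj (ψ t))) (⟪(u : E d), x⟫_ℝ - b) =
      windowInner η ψ * φ x := fun u => by
    rw [integral_sub_left_eq_self (fun t => φ x * (η t * conj (ψ t))), integral_const_mul,
      windowInner, mul_comm]
  simp only [h2]
  simp

lemma sin_ne_zero_of_mem_Ioo {t : ℝ} (h : t ∈ Set.Ioo (-Real.pi) Real.pi) (h0 : t ≠ 0) :
    Real.sin t ≠ 0 := fun hs => h0 ((Real.sin_eq_zero_iff_of_lt_of_lt h.1 h.2).1 hs)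

end DSTFRFT

end

/-- The dimension is `n = d + 1 ≥ 2`. -/
theorem proposition5p4 {d : ℕ} (hd : 1 ≤ d) (α : Fin (d + 1) → ℝ)
    (hα : ∀ k, α k ∈ Set.Ioo (-Real.pi) Real.pi ∧ α k ≠ 0)
    (ψ η : 𝓢(ℝ, ℂ)) (hη : DSTFRFT.IsSynthesisWindow η ψ) :
    (∃! T : DSTFRFT.TemperedDual d →ₗ[ℂ] DSTFRFT.SchwartzYDual d,
      DSTFRFT.IsDistDSTFRFT α ψ T) ∧
    (∃! S : DSTFRFT.SchwartzYDual d →ₗ[ℂ] DSTFRFT.TemperedDual d,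
      DSTFRFT.IsDistSynthesis α η S) ∧
    ∀ (T : DSTFRFT.TemperedDual d →ₗ[ℂ] DSTFRFT.SchwartzYDual d)
      (S : DSTFRFT.SchwartzYDual d →ₗ[ℂ] DSTFRFT.TemperedDual d),
      DSTFRFT.IsDistDSTFRFT α ψ T → DSTFRFT.IsDistSynthesis α η S →
      (DSTFRFT.windowInner η ψ)⁻¹ • (S ∘ₗ T) = LinearMap.id := by
  have hs : ∀ k, Real.sin (α k) ≠ 0 := fun k =>
    DSTFRFT.sin_ne_zero_of_mem_Ioo (hα k).1 (hα k).2
  have hs' : ∀ k, Real.sin ((-α) k) ≠ 0 := fun k => by simpa using hs k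
  obtain ⟨A, hA⟩ := DSTFRFT.exists_analysisCLM hs' η
  obtain ⟨B, hB⟩ := DSTFRFT.exists_synthesisCLM hs (DSTFRFT.conjT ψ)
  have hB' : ∀ (Φ : DSTFRFT.SchwartzY d) x, B Φ x =
      conj (DSTFRFT.synthesis α ψ (fun y => conj (Φ y)) x) := fun Φ x => by
    rw [hB, DSTFRFT.conj_synthesis α ψ (DSTFRFT.rapid_coe Φ)]
  have hA' : ∀ φ y, A φ y = conj (DSTFRFT.dstfrft α η (fun x => conj (φ x)) y) := fun φ y => by
    rw [hA, DSTFRFT.conj_dstfrft]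
  -- A Schwartz function is determined by its values, so the function in the duality formula can
  -- only be `B Φ`; this gives uniqueness.
  have hT : ∀ T, DSTFRFT.IsDistDSTFRFT α ψ T → ∀ f Φ, T f Φ = f (B Φ) := fun T h f Φ => by
    obtain ⟨g, hg, e⟩ := h Φ
    rw [e f, show g = B Φ from SchwartzMap.ext fun x => by rw [hg, hB']]
  have hS : ∀ S, DSTFRFT.IsDistSynthesis α η S → ∀ F φ, S F φ = F (A φ) := fun S h F φ => by
    obtain ⟨g, hg, e⟩ := h φ
    rw [e F, show g = A φ from Subtype.ext (funext fun y => (hg y).trans (hA' φ y).symm)]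
  refine ⟨⟨{ toFun := fun f => f.comp B
             map_add' := fun f g => rfl
             map_smul' := fun c f => rfl }, fun Φ => ⟨B Φ, hB' Φ, fun f => rfl⟩, fun T h => ?_⟩,
    ⟨{ toFun := fun F => F.comp A
       map_add' := fun f g => rfl
       map_smul' := fun c f => rfl }, fun φ => ⟨A φ, hA' φ, fun F => rfl⟩, fun S h => ?_⟩,
    fun T S h h' => ?_⟩
  · exact LinearMap.ext fun f => ContinuousLinearMap.ext fun Φ => hT T h f Φ
  · exact LinearMap.ext fun F => ContinuousLinearMap.ext fun φ => hS S h F φ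
  · refine LinearMap.ext fun f => ContinuousLinearMap.ext fun φ => ?_
    -- By transposition the composition sends `f` to `f ∘ B ∘ A`, so the reconstruction formula on
    -- test functions is enough.
    have e : B (A φ) = DSTFRFT.windowInner η ψ • φ := SchwartzMap.ext fun x => by
      rw [hB, DSTFRFT.G_conjT_analysis hs ψ η φ (A φ) (hA φ)]
      rfl
    change (DSTFRFT.windowInner η ψ)⁻¹ • (S (T f) φ) = f φ
    rw [hS S h', hT T h, e, map_smul, smul_smul, inv_mul_cancel₀ hη, one_smul]
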